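/- Let $(X,\mathcal C,m,T)$ be a probability measure preserving system, let $\varphi:X\to\mathbb R$ be measurable, and put $S_0=0$, $S_n=\sum_{k=1}^{n}\varphi\circ T^{k-1}$. Let $\hat T:L^1(m)\to L^1(m)$ be the transfer operator, $\int \hat T u\cdot v\,dm=\int u\cdot v\circ T\,dm$ for $u\in L^1(m)$, $v\in L^\infty(m)$, and $P(t)u=\hat T(e^{it\varphi}u)$ for $t\in\mathbb R$. Write $m(u)=\int u\,dm$, and $\rho$ for the spectral radius of a bounded operator on $\mathcal B$. Assume: (A1) $\mathcal B\subseteq L^\infty(m)$ is a complex Banach space with norm $\|\cdot\|$ such that $\|\cdot\|_\infty\le c\|\cdot\|$ for some $c>0$, $\mathbb 1\in\mathcal B$, and $\bar u,|u|\in\mathcal B$ whenever $u\in\mathcal B$. (A2) $\hat T$ is a bounded operator on $\mathcal B$ of the form $\hat T u=m(u)\mathbb 1+Nu$ with $\rho(N)<1$ (so $\hat T$ is quasi-compact on $\mathcal B$ with the one dominating simple eigenvalue $1$). (A3) $\varphi\in L^2(m)$ and $m(\varphi)=0$. (A4) $P(t)$ is a bounded operator on $\mathcal B$ for every $t$, and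 $t\mapsto P(t)\in \mathrm{Hom}(\mathcal B,\mathcal B)$ is continuous on $\mathbb R$ in operator norm. (A5) $t\mapsto P(t)\in\mathrm{Hom}(\mathcal B,\mathcal B)$ is twice continuously differentiable in a neighbourhood of $0$, with $P'(0)u=\hat T(i\varphi u)$ and $P''(0)u=\hat T(-\varphi^2u)$. (A6) $\rho(P(t))<1$ for all $t\ne0$. (A7) The processes $\omega_n(t)=n^{-1/2}S_{\lfloor nt\rfloor}$, $t\in[0,1]$, converge in law, in the Skorokhod space $D$ of càdlàg functions on $[0,1]$, to a centred Brownian motion $\omega$ with $E(\omega(1)^2)>0$. Let $f:\mathbb R\to\mathbb R$ be smooth, integrable and symmetric ($f(-s)=f(s)$), with compactly supported Fourier transform, and let $$l_n(x)=n^{-1/2}\sum_{k=1}^{n}f\bigl(S_k-\sqrt n\,x\bigr),\qquad x\in\mathbb R.$$ Then there is a constant $C>0$ such that for all $n\in\mathbb N$ and all $x,y\in\mathbb R$ $$m\Bigl(\Bigl(\sum_{k=1}^{n}\bigl(f(S_k-x)-f(S_k-y)\bigr)\Bigr)^4\Bigr)\le C\,n\,|x-y|^2 .$$ As a consequence, there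 is a constant $C>0$ such that for all $n\in\mathbb N$ and all $x,y\in\mathbb R$ $$m\bigl((l_n(x)-l_n(y))^4\bigr)\le C\,|x-y|^2 .$$ -/

import Mathlib

open MeasureTheory ProbabilityTheory Filter Topology
open scoped ENNReal NNReal ContDiff FourierTransform unitInterval

/-! ### The transfer operator -/

section Transfer

variable {X : Type*} [MeasurableSpace X]

/-- The transfer (Frobenius-Perron) operator of `T` on integrable functions `f : X → ℂ`: the
density with respect to `m` of the image under `T` of the complex measure `f dm`. It is
characterized by `integral_transferFun_mul` below. -/
noncomputable def transferFun (m : Measure X) (T : X → X) (f : X → ℂ) : X → ℂ :=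
  ComplexMeasure.rnDeriv ((m.withDensityᵥ f).map T) m

theorem integrable_transferFun (m : Measure X) (T : X → X) (f : X → ℂ) :
    Integrable (transferFun m T f) m :=
  ComplexMeasure.integrable_rnDeriv _ _

theorem setIntegral_transferFun {m : Measure X} [IsProbabilityMeasure m] {T : X → X}
    (hT : MeasurePreserving T m m) {f : X → ℂ} (hf : Integrable f m) {A : Set X}
    (hA : MeasurableSet A) :
    ∫ x in A, transferFun m T f x ∂m = ∫ x in T ⁻¹' A, f x ∂m := by
  set c : ComplexMeasure X := (m.withDensityᵥ f).map T with hc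
  have hval : ∀ s, MeasurableSet s → c s = ∫ x in T ⁻¹' s, f x ∂m := fun s hs => by
    rw [hc, VectorMeasure.map_apply _ hT.measurable hs,
      withDensityᵥ_apply hf (hT.measurable hs)]
  have habs : ∀ s, MeasurableSet s → m s = 0 → c s = 0 := fun s hs h0 => by
    rw [hval s hs]
    refine Measure.restrict_eq_zero.2 ?_ ▸ integral_zero_measure _
    rw [hT.measure_preimage hs.nullMeasurableSet, h0]
  have hre : m.withDensityᵥ (c.re.rnDeriv m) = c.re := by
    rw [← SignedMeasure.absolutelyContinuous_iff_withDensityᵥ_rnDeriv_eq]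
    refine VectorMeasure.AbsolutelyContinuous.mk fun s hs h0 => ?_
    rw [Measure.toENNRealVectorMeasure_apply_measurable hs] at h0
    change (c s).re = 0
    rw [habs s hs h0]; rfl
  have him : m.withDensityᵥ (c.im.rnDeriv m) = c.im := by
    rw [← SignedMeasure.absolutelyContinuous_iff_withDensityᵥ_rnDeriv_eq]
    refine VectorMeasure.AbsolutelyContinuous.mk fun s hs h0 => ?_
    rw [Measure.toENNRealVectorMeasure_apply_measurable hs] at h0
    change (c s).im = 0
    rw [habs s hs h0]; rfl
  rw [← hval A hA]
  have hint := (integrable_transferFun m T f).integrableOn (s := A)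
  apply Complex.ext
  · rw [← RCLike.re_eq_complex_re, ← integral_re hint]
    change ∫ x in A, c.re.rnDeriv m x ∂m = c.re A
    rw [← withDensityᵥ_apply (SignedMeasure.integrable_rnDeriv _ _) hA, hre]
  · rw [← RCLike.im_eq_complex_im, ← integral_im hint]
    change ∫ x in A, c.im.rnDeriv m x ∂m = c.im A
    rw [← withDensityᵥ_apply (SignedMeasure.integrable_rnDeriv _ _) hA, him]

/-- The duality that defines the transfer operator:
`∫ (T̂ f) g dm = ∫ f (g ∘ T) dm` for integrable `f` and bounded `g`. -/
theorem integral_transferFun_mul {m : Measure X} [IsProbabilityMeasure m] {T : X → X}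
    (hT : MeasurePreserving T m m) {f g : X → ℂ} (hf : Integrable f m) (hg : Measurable g)
    {K : ℝ} (hK : ∀ x, ‖g x‖ ≤ K) :
    ∫ x, transferFun m T f x * g x ∂m = ∫ x, f x * g (T x) ∂m := by
  have hle : MeasurableSpace.comap T inferInstance ≤ (inferInstance : MeasurableSpace X) :=
    hT.measurable.comap_le
  have hTi : Integrable (fun x => transferFun m T f (T x)) m :=
    hT.integrable_comp_of_integrable (integrable_transferFun m T f)
  have hTm : Measurable[MeasurableSpace.comap T inferInstance] T := comap_measurable T
  have hmeas : AEStronglyMeasurable[MeasurableSpace.comap T inferInstance]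
      (fun x => transferFun m T f (T x)) m := by
    obtain ⟨h, hh, hae⟩ := (integrable_transferFun m T f).aestronglyMeasurable
    exact ⟨fun x => h (T x), hh.comp_measurable hTm, hT.quasiMeasurePreserving.ae_eq_comp hae⟩
  have hce : (fun x => transferFun m T f (T x)) =ᵐ[m]
      m[f | MeasurableSpace.comap T inferInstance] := by
    refine ae_eq_condExp_of_forall_setIntegral_eq hle hf (fun s _ _ => hTi.integrableOn)
      ?_ hmeas
    rintro s ⟨A, hA, rfl⟩ _
    rw [← setIntegral_transferFun hT hf hA]
    have hsm := (integrable_transferFun m T f).aestronglyMeasurable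
    generalize transferFun m T f = h at hsm
    have key := setIntegral_map (μ := m) (g := T) (f := h) hA (by rwa [hT.map_eq]) hT.aemeasurable
    rw [hT.map_eq] at key
    exact key.symm
  have hgT : StronglyMeasurable[MeasurableSpace.comap T inferInstance] fun x => g (T x) :=
    (hg.comp hTm).stronglyMeasurable
  have hfg : Integrable (f * fun x => g (T x)) m :=
    hf.mul_bdd (c := K) (hgT.mono hle).aestronglyMeasurable (ae_of_all _ fun x => hK (T x))
  have hpull := condExp_bilin_of_stronglyMeasurable_right (ContinuousLinearMap.mul ℝ ℂ) hgT hfg hf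
  calc ∫ x, transferFun m T f x * g x ∂m
      = ∫ x, transferFun m T f (T x) * g (T x) ∂m := by
        have hsm := (integrable_transferFun m T f).aestronglyMeasurable
        generalize transferFun m T f = h at hsm
        have key := integral_map (μ := m) (φ := T) (f := fun x => h x * g x) hT.aemeasurable
          (by rw [hT.map_eq]; exact hsm.mul hg.aestronglyMeasurable)
        rw [hT.map_eq] at key
        exact key
    _ = ∫ x, (m[f * (fun x => g (T x)) | MeasurableSpace.comap T inferInstance]) x ∂m := by
        refine integral_congr_ae ?_
        filter_upwards [hce, hpull] with x h1 h2
        rw [h1]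
        exact h2.symm
    _ = ∫ x, f x * g (T x) ∂m := by
        rw [integral_condExp hle]; rfl

/-- The characteristic function operator `P(t) f = T̂ (e^{itφ} f)`. -/
noncomputable def charFunOp (m : Measure X) (T : X → X) (φ : X → ℝ) (t : ℝ) (f : X → ℂ) : X → ℂ :=
  transferFun m T fun x => Complex.exp (Complex.I * t * φ x) * f x

end Transfer

/-! ### Skorokhod space -/

/-- `x : [0,1] → ℝ` is càdlàg: right-continuous with (finite) left limits. -/
def IsCadlag (x : I → ℝ) : Prop :=
  ∀ t, ContinuousWithinAt x (Set.Ici t) t ∧ ∃ l, Tendsto x (𝓝[<] t) (𝓝 l)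

/-- The space `D` of càdlàg functions on `[0,1]`. -/
def SkorokhodSpace : Type := {x : I → ℝ // IsCadlag x}

namespace SkorokhodSpace

instance : CoeFun SkorokhodSpace fun _ => I → ℝ := ⟨Subtype.val⟩

/-- The Skorokhod distance: the infimum over the increasing bijections `τ` of `[0,1]` of
`max (sup_t |τ t - t|) (sup_t |x t - y (τ t)|)`. -/
noncomputable instance : PseudoEMetricSpace SkorokhodSpace where
  edist x y := ⨅ τ : I ≃o I, max (⨆ t, edist (τ t) t) (⨆ t, edist (x t) (y (τ t)))
  edist_self x := by
    refine le_antisymm (iInf_le_of_le (OrderIso.refl I) ?_) zero_le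
    simp
  edist_comm := by
    have key : ∀ x y : SkorokhodSpace,
        (⨅ τ : I ≃o I, max (⨆ t, edist (τ t) t) (⨆ t, edist (x t) (y (τ t)))) ≤
        ⨅ τ : I ≃o I, max (⨆ t, edist (τ t) t) (⨆ t, edist (y t) (x (τ t))) := by
      intro x y
      refine le_iInf fun τ => iInf_le_of_le τ.symm (max_le_max ?_ ?_)
      · refine iSup_le fun t => le_iSup_of_le (τ.symm t) ?_
        rw [OrderIso.apply_symm_apply, edist_comm]
      · refine iSup_le fun t => le_iSup_of_le (τ.symm t) ?_
        rw [OrderIso.apply_symm_apply, edist_comm]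
    exact fun x y => le_antisymm (key x y) (key y x)
  edist_triangle x y z := by
    refine ENNReal.le_iInf_add_iInf fun τ ρ => iInf_le_of_le (τ.trans ρ) (max_le ?_ ?_)
    · refine iSup_le fun t => ?_
      calc edist ((τ.trans ρ) t) t ≤ edist (ρ (τ t)) (τ t) + edist (τ t) t := edist_triangle _ _ _
        _ = edist (τ t) t + edist (ρ (τ t)) (τ t) := add_comm _ _
        _ ≤ _ := add_le_add (le_max_of_le_left (le_iSup (fun t => edist (τ t) t) t))
          (le_max_of_le_left (le_iSup (fun t => edist (ρ t) t) (τ t)))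
    · refine iSup_le fun t => (edist_triangle _ (y (τ t)) _).trans ?_
      exact add_le_add (le_max_of_le_right (le_iSup (fun t => edist (x t) (y (τ t))) t))
        (le_max_of_le_right (le_iSup (fun t => edist (y t) (z (ρ t))) (τ t)))

noncomputable instance : MeasurableSpace SkorokhodSpace := borel _

instance : BorelSpace SkorokhodSpace := ⟨rfl⟩

end SkorokhodSpace

/-! ### Birkhoff sums, rescaled paths, local time -/

section Sums

variable {X : Type*}

/-- `S_n = ∑_{k=1}^n X_k` where `X_k = φ ∘ T^{k-1}`. -/
def ergodicSum (T : X → X) (φ : X → ℝ) (n : ℕ) (x : X) : ℝ :=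
  ∑ k ∈ Finset.range n, φ (T^[k] x)

theorem isCadlag_comp_floor (n : ℕ) (s : ℕ → ℝ) :
    IsCadlag fun t : I => s ⌊(n : ℝ) * (t : ℝ)⌋₊ := by
  have hc : Continuous fun t : I => (n : ℝ) * (t : ℝ) := by fun_prop
  have hnn : ∀ t : I, 0 ≤ (n : ℝ) * (t : ℝ) := fun t => mul_nonneg n.cast_nonneg t.2.1
  intro t
  constructor
  · have h1 : ∀ᶠ u : I in 𝓝[≥] t, ⌊(n : ℝ) * (u : ℝ)⌋₊ = ⌊(n : ℝ) * (t : ℝ)⌋₊ := by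
      have h2 : ∀ᶠ u : I in 𝓝[≥] t, (n : ℝ) * (u : ℝ) < ⌊(n : ℝ) * (t : ℝ)⌋₊ + 1 :=
        nhdsWithin_le_nhds (hc.continuousAt.eventually (gt_mem_nhds (Nat.lt_floor_add_one _)))
      filter_upwards [h2, self_mem_nhdsWithin] with u hu hut
      rw [Nat.floor_eq_iff (hnn u)]
      have : (t : ℝ) ≤ u := hut
      exact ⟨(Nat.floor_le (hnn t)).trans (by gcongr), hu⟩
    refine tendsto_const_nhds.congr' ?_
    filter_upwards [h1] with u hu
    rw [hu]
  · refine ⟨s (⌈(n : ℝ) * (t : ℝ)⌉₊ - 1), tendsto_const_nhds.congr' ?_⟩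
    rcases Nat.eq_zero_or_pos n with rfl | hn
    · simp
    have hn' : (0 : ℝ) < n := by exact_mod_cast hn
    rcases (hnn t).eq_or_lt with h0 | h0
    · filter_upwards [self_mem_nhdsWithin] with u hu
      have hut : (u : ℝ) < t := hu
      have := mul_lt_mul_of_pos_left hut hn'
      exact absurd (hnn u) (by linarith)
    have hpos : 0 < ⌈(n : ℝ) * (t : ℝ)⌉₊ := Nat.ceil_pos.2 h0
    have hlt : ((⌈(n : ℝ) * (t : ℝ)⌉₊ - 1 : ℕ) : ℝ) < (n : ℝ) * (t : ℝ) :=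
      Nat.lt_ceil.1 (by omega)
    have h2 : ∀ᶠ u : I in 𝓝[<] t, ((⌈(n : ℝ) * (t : ℝ)⌉₊ - 1 : ℕ) : ℝ) < (n : ℝ) * (u : ℝ) :=
      nhdsWithin_le_nhds (hc.continuousAt.eventually (lt_mem_nhds hlt))
    filter_upwards [h2, self_mem_nhdsWithin] with u hu hut
    have hut' : (u : ℝ) < t := hut
    have h3 := mul_lt_mul_of_pos_left hut' hn'
    congr 1
    symm
    rw [Nat.floor_eq_iff (hnn u)]
    refine ⟨hu.le, ?_⟩
    have h4 : ((⌈(n : ℝ) * (t : ℝ)⌉₊ - 1 : ℕ) : ℝ) + 1 = (⌈(n : ℝ) * (t : ℝ)⌉₊ : ℕ) := by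
      rw [Nat.cast_sub hpos]; simp
    rw [h4]
    exact h3.trans_le (Nat.le_ceil _)

/-- The rescaled path `ω_n(t) = n^{-1/2} ∑_{k=1}^{[nt]} X_k`, `t ∈ [0,1]`. -/
noncomputable def rescaledPath (T : X → X) (φ : X → ℝ) (n : ℕ) (x : X) : SkorokhodSpace :=
  ⟨fun t => ergodicSum T φ ⌊(n : ℝ) * (t : ℝ)⌋₊ x / √n,
    isCadlag_comp_floor n fun k => ergodicSum T φ k x / √n⟩

/-- The local time `l_n(a) = n^{-1/2} ∑_{k=1}^n f(S_k - √n a)`. -/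
noncomputable def localTime (T : X → X) (φ : X → ℝ) (f : ℝ → ℝ) (n : ℕ) (a : ℝ) (x : X) : ℝ :=
  (√n)⁻¹ * ∑ k ∈ Finset.Icc 1 n, f (ergodicSum T φ k x - √n * a)

end Sums

/-! ### The standing assumptions -/

section Assumptions

variable {X : Type*} [MeasurableSpace X] {m : Measure X}
  {B : Type*} [NormedAddCommGroup B] [NormedSpace ℂ B]

/-- The (bounded) linear map `ι` presents `B` as a Banach space contained in `L^∞(m)`, with
`‖·‖_∞ ≤ C ‖·‖`, that contains the constant function `1` and is closed under complex conjugation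
and absolute value. -/
structure IsBanachFunctionSpace (ι : B →L[ℂ] Lp ℂ ∞ m) : Prop where
  injective : Function.Injective ι
  one_mem : ∃ e, ι e =ᵐ[m] fun _ => 1
  conj_mem : ∀ b, ∃ c, ι c =ᵐ[m] fun x => (starRingEnd ℂ) (ι b x)
  abs_mem : ∀ b, ∃ c, ι c =ᵐ[m] fun x => ((‖ι b x‖ : ℝ) : ℂ)

/-- For every `t`, the characteristic function operator `P(t)` leaves `B` invariant, and its
restriction to `B` is the bounded operator `P t`. -/
def RestrictsTo (T : X → X) (φ : X → ℝ) (ι : B →L[ℂ] Lp ℂ ∞ m) (P : ℝ → B →L[ℂ] B) : Prop :=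
  ∀ t b, ι (P t b) =ᵐ[m] charFunOp m T φ t (ι b)

/-- Quasi-compactness of `T̂ = P(0)` on `B`, with the one dominating simple eigenvalue `1`:
`T̂ b = m(b) 1 + N b` where the spectral radius of `N` is less than `1`. -/
def IsQuasiCompactTransfer (ι : B →L[ℂ] Lp ℂ ∞ m) (P : ℝ → B →L[ℂ] B) : Prop :=
  ∃ N : B →L[ℂ] B,
    (∀ b, ι (P 0 b) =ᵐ[m] fun x => (∫ y, ι b y ∂m) + ι (N b) x) ∧ spectralRadius ℂ N < 1

/-- `t ↦ P t` is twice continuously differentiable near `0`, with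
`P'(0) b = T̂ (i φ b)` and `P''(0) b = T̂ (- φ² b)`. -/
def IsDifferentiableNearZero (T : X → X) (φ : X → ℝ) (ι : B →L[ℂ] Lp ℂ ∞ m)
    (P : ℝ → B →L[ℂ] B) : Prop :=
  (∃ U : Set ℝ, IsOpen U ∧ 0 ∈ U ∧ ContDiffOn ℝ 2 P U) ∧
  (∀ b, ι (deriv P 0 b) =ᵐ[m] transferFun m T fun x => Complex.I * φ x * ι b x) ∧
  (∀ b, ι (deriv (deriv P) 0 b) =ᵐ[m] transferFun m T fun x => -((φ x : ℂ) ^ 2) * ι b x)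

/-- Aperiodicity: the spectral radius of `P t` on `B` is less than `1` for `t ≠ 0`. -/
def IsAperiodicFamily (P : ℝ → B →L[ℂ] B) : Prop :=
  ∀ t, t ≠ 0 → spectralRadius ℂ (P t) < 1

end Assumptions

/-- The functional invariance principle: the rescaled paths converge in law, in the Skorokhod space
`D`, to a non-degenerate Brownian motion `a W`, `a > 0`, restricted to `[0,1]`. The Brownian motion
lives on the probability space `(Ω, Q)`. -/
def FunctionalInvariancePrinciple {X : Type*} [MeasurableSpace X] (m : Measure X)
    [IsProbabilityMeasure m] (T : X → X) (φ : X → ℝ) {Ω : Type*} [MeasurableSpace Ω]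
    (Q : Measure Ω) [IsProbabilityMeasure Q] : Prop :=
  ∃ (W : ℝ≥0 → Ω → ℝ) (a : ℝ) (w : Ω → SkorokhodSpace),
    IsBrownianReal W Q ∧ 0 < a ∧ (∀ᵐ z ∂Q, ∀ t : I, w z t = a * W (unitInterval.toNNReal t) z) ∧
    TendstoInDistribution (rescaledPath T φ) atTop w (fun _ => m) Q

/-! By Fourier inversion, `f (s - x) - f (s - y)` is the Fourier integral of a function `g` that has
bounded support and satisfies `‖g t‖ ≤ A ψ(t)`, where `ψ(t) = min(1, δ|t|)` and `δ = |x - y|`.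
Expand the fourth power into a sum over quadruples of times and sort each quadruple. The cocycle
identity splits the phase `∑ tᵢ S_{kᵢ}` into blocks along the gaps `lᵢ`. Duality turns the
expectation into the mass of a product of powers `P(2πuᵢ)^{lᵢ}` applied to `1`, where `u₄ = t₄`, `u₃
= t₃ + t₄`, and so on (`integral_phase_four_eq`).

Dynamics enters only through the bound `‖P(t)^k‖ ≤ K exp(-c t² k)` on compact sets
(`exists_norm_pow_le_gaussian`). Away from `0` it follows from spectral radius less than `1`, which
persists under small perturbation, and from compactness. Near `0` it comes from the central limit
theorem: for `n` about `(s/t)²` the characteristic function `m(e^{itS_n})` is small. Since `P(t)` is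
a rank one operator plus an operator with decaying powers, this forces `‖P(t)^L‖ ≤ 1/2` for some `L
= O(t⁻²)`, hence decay at rate `t²`.

Summing over each gap separately produces `G(u) = ∑_{l ≤ n} exp(-c u² l)`, truncated to a bounded
interval. Then `∫ G = O(√n)`, and `∫ ψ² G = O(δ)` uniformly in `n`, because `G(u) = O(u⁻²)`. By
Cauchy-Schwarz, `∫ ψ G = O(n^{1/4} δ^{1/2})`. Finally `ψ(tᵢ) = ψ(uᵢ - uᵢ₊₁) ≤ ψ(uᵢ) + ψ(uᵢ₊₁)`, so
no variable carries more than two factors `ψ`. Each of the four factors `ψ` replaces one of the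
eight factors `n^{1/4}` by `δ^{1/2}`, which leaves `n δ²` (`lintegral_chain_four_le`). -/

/-! ### Power bounds for bounded operators -/

section PowerBounds

/-- If one power of `a` has norm at most `1/2`, the powers of `a` decay exponentially. -/
theorem norm_pow_le_exp_of_norm_pow_le_half {A : Type*} [NormedRing A] {a : A} {L : ℕ} (hL : 0 < L)
    (h : ‖a ^ L‖ ≤ 1 / 2) {K : ℝ} (hK : ∀ j < L, ‖a ^ j‖ ≤ K) (k : ℕ) :
    ‖a ^ k‖ ≤ 2 * K * Real.exp (-(Real.log 2 / L) * k) := by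
  have hK0 : 0 ≤ K := (norm_nonneg _).trans (hK 0 hL)
  have hL' : (0 : ℝ) < L := by exact_mod_cast hL
  have step : ∀ q r : ℕ, r < L → ‖a ^ (L * q + r)‖ ≤ (1 / 2) ^ q * K := by
    intro q r hr
    induction q with
    | zero => simpa using hK r hr
    | succ q ih =>
      have : a ^ (L * (q + 1) + r) = a ^ L * a ^ (L * q + r) := by rw [← pow_add]; congr 1; ring
      rw [this]
      calc ‖a ^ L * a ^ (L * q + r)‖ ≤ ‖a ^ L‖ * ‖a ^ (L * q + r)‖ := norm_mul_le _ _
        _ ≤ 1 / 2 * ((1 / 2) ^ q * K) := by gcongr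
        _ = _ := by ring
  have h1 := step (k / L) (k % L) (Nat.mod_lt _ hL)
  rw [Nat.div_add_mod] at h1
  refine h1.trans ?_
  -- Rounding `k / L` down loses at most one factor `1/2`; this is the `2` in the constant.
  have h2 : (k : ℝ) / L ≤ (k / L : ℕ) + 1 := by
    rw [div_le_iff₀ hL']
    have : k < L * (k / L) + L := by
      have := Nat.div_add_mod k L; have := Nat.mod_lt k hL; omega
    have h3 : (k : ℝ) < L * (k / L : ℕ) + L := by exact_mod_cast this
    linarith
  have h3 : ((1 : ℝ) / 2) ^ (k / L) = 2 * Real.exp (-Real.log 2 * ((k / L : ℕ) + 1)) := by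
    rw [show -Real.log 2 * (((k / L : ℕ) : ℝ) + 1)
      = ((k / L : ℕ) : ℝ) * Real.log (1 / 2) + Real.log (1 / 2) by
        rw [one_div, Real.log_inv]; ring, Real.exp_add, Real.exp_log (by norm_num),
      Real.exp_nat_mul, Real.exp_log (by norm_num)]
    ring
  rw [h3]
  have h4 : Real.exp (-Real.log 2 * ((k / L : ℕ) + 1)) ≤ Real.exp (-(Real.log 2 / L) * k) := by
    apply Real.exp_le_exp.2
    have := mul_le_mul_of_nonneg_left h2 (Real.log_nonneg one_le_two)
    have e : -(Real.log 2 / L) * k = -(Real.log 2 * (k / L)) := by ring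
    rw [e]; linarith
  calc 2 * Real.exp (-Real.log 2 * ((k / L : ℕ) + 1)) * K
      ≤ 2 * Real.exp (-(Real.log 2 / L) * k) * K := by gcongr
    _ = _ := by ring

/-- Elements near an element of spectral radius less than `1` have uniformly exponentially
decaying powers. -/
theorem eventually_norm_pow_le_exp {A : Type*} [NormedRing A] [NormedAlgebra ℂ A] [CompleteSpace A]
    {a : A} (ha : spectralRadius ℂ a < 1) :
    ∃ K c : ℝ, 0 < K ∧ 0 < c ∧ ∀ᶠ b in 𝓝 a, ∀ k : ℕ, ‖b ^ k‖ ≤ K * Real.exp (-c * k) := by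
  obtain ⟨r, hr1, hr2⟩ := ENNReal.lt_iff_exists_nnreal_btwn.1 ha
  have hr2' : (r : ℝ) < 1 := by exact_mod_cast hr2
  -- Gelfand's formula.
  have hev : ∀ᶠ n : ℕ in atTop, ‖a ^ n‖ ≤ (r : ℝ) ^ n := by
    filter_upwards [(spectrum.pow_nnnorm_pow_one_div_tendsto_nhds_spectralRadius a).eventually
      (gt_mem_nhds hr1), eventually_gt_atTop 0] with n hn hn0
    have hn0' : (0 : ℝ) < n := by exact_mod_cast hn0
    rw [one_div, ENNReal.rpow_inv_lt_iff hn0', ENNReal.rpow_natCast] at hn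
    have : ‖a ^ n‖₊ < r ^ n := by exact_mod_cast hn
    exact_mod_cast this.le
  have hpow : ∀ᶠ n : ℕ in atTop, (r : ℝ) ^ n < 1 / 2 :=
    (tendsto_pow_atTop_nhds_zero_of_lt_one r.2 hr2').eventually (gt_mem_nhds (by norm_num))
  obtain ⟨L, hL1, hL2, hL0⟩ := (hev.and (hpow.and (eventually_gt_atTop 0))).exists
  refine ⟨2 * ∑ j ∈ Finset.range L, (‖a ^ j‖ + 1), Real.log 2 / L, ?_, ?_, ?_⟩
  · have : 0 < ∑ j ∈ Finset.range L, (‖a ^ j‖ + 1) :=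
      Finset.sum_pos (fun j _ => by positivity) ⟨0, by simpa using hL0⟩
    linarith
  · have : (0 : ℝ) < L := by exact_mod_cast hL0
    have := Real.log_pos one_lt_two
    positivity
  -- Only finitely many powers are constrained, each by a strict inequality, so the constraints are
  -- open in `b`.
  · have h1 : ∀ᶠ b in 𝓝 a, ‖b ^ L‖ < 1 / 2 :=
      ((continuous_pow L).norm.tendsto a).eventually (gt_mem_nhds (hL1.trans_lt hL2))
    have h2 : ∀ᶠ b in 𝓝 a, ∀ j ∈ Finset.range L, ‖b ^ j‖ < ‖a ^ j‖ + 1 :=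
      (Finset.eventually_all _).2 fun j _ =>
        ((continuous_pow j).norm.tendsto a).eventually (gt_mem_nhds (lt_add_one _))
    filter_upwards [h1, h2] with b hb1 hb2 k
    refine norm_pow_le_exp_of_norm_pow_le_half hL0 hb1.le (fun j hj => ?_) k
    refine (hb2 j (Finset.mem_range.2 hj)).le.trans ?_
    exact Finset.single_le_sum (f := fun j => ‖a ^ j‖ + 1) (fun i _ => by positivity)
      (Finset.mem_range.2 hj)

variable {B : Type*} [NormedAddCommGroup B] [NormedSpace ℂ B]

/-- Powers of a rank one perturbation `M(·) e + N` of `N`, applied to a vector. -/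
theorem pow_apply_eq_of_rankOne_add {p N : B →L[ℂ] B} {M : B →L[ℂ] ℂ} {e : B}
    (hp : ∀ b, p b = M b • e + N b) (n : ℕ) (b : B) :
    (p ^ n) b = (N ^ n) b + ∑ j ∈ Finset.range n, M ((p ^ j) b) • (N ^ (n - 1 - j)) e := by
  induction n with
  | zero => simp
  | succ n ih =>
    have h1 : (p ^ (n + 1)) b = p ((p ^ n) b) := by rw [pow_succ']; rfl
    have h2 : ∀ v, (N ^ (n + 1)) v = N ((N ^ n) v) := fun v => by rw [pow_succ']; rfl
    have h4 : N ((p ^ n) b)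
        = N ((N ^ n) b) + ∑ j ∈ Finset.range n, N (M ((p ^ j) b) • (N ^ (n - 1 - j)) e) := by
      rw [ih, map_add, map_sum]
    rw [h1, hp, Finset.sum_range_succ, h2, h4]
    simp only [Nat.add_sub_cancel, Nat.sub_self, pow_zero, one_apply_eq_self]
    have h3 : ∑ j ∈ Finset.range n, N (M ((p ^ j) b) • (N ^ (n - 1 - j)) e)
        = ∑ j ∈ Finset.range n, M ((p ^ j) b) • (N ^ (n - j)) e := by
      refine Finset.sum_congr rfl fun j hj => ?_
      rw [map_smul]
      congr 1
      have : n - j = (n - 1 - j) + 1 := by have := Finset.mem_range.1 hj; omega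
      rw [this, pow_succ']; rfl
    rw [h3]
    abel

/-- If the powers of `N` decay exponentially and the functionals `b ↦ M (p^j b)`, `j < n`, have
norm at most `η`, the `n`-th power of `p = M(·) e + N` is controlled. -/
theorem norm_pow_apply_le_of_rankOne_add {p N : B →L[ℂ] B} {M : B →L[ℂ] ℂ} {e : B}
    (hp : ∀ b, p b = M b • e + N b) {K c : ℝ} (hK : 0 < K) (hc : 0 < c)
    (hN : ∀ k : ℕ, ‖N ^ k‖ ≤ K * Real.exp (-c * k)) (n : ℕ) (b : B) {η : ℝ}
    (hη : ∀ j < n, ‖M ((p ^ j) b)‖ ≤ η) (hη0 : 0 ≤ η) :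
    ‖(p ^ n) b‖ ≤ K * Real.exp (-c * n) * ‖b‖ + η * (K * (1 - Real.exp (-c))⁻¹ * ‖e‖) := by
  rw [pow_apply_eq_of_rankOne_add hp]
  have hx : Real.exp (-c) < 1 := Real.exp_lt_one_iff.2 (by linarith)
  have hexp : ∀ k : ℕ, Real.exp (-c * k) = Real.exp (-c) ^ k := fun k => by
    rw [← Real.exp_nat_mul]; ring_nf
  have hgeom : ∑ j ∈ Finset.range n, Real.exp (-c) ^ (n - 1 - j) ≤ (1 - Real.exp (-c))⁻¹ := by
    rw [Finset.sum_range_reflect (fun j => Real.exp (-c) ^ j)]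
    rw [← tsum_geometric_of_lt_one (Real.exp_pos _).le hx]
    exact (summable_geometric_of_lt_one (Real.exp_pos _).le hx).sum_le_tsum _
      fun i _ => by positivity
  refine (norm_add_le _ _).trans (add_le_add ?_ ?_)
  · exact (N ^ n).le_of_opNorm_le (hN n) b
  · calc ‖∑ j ∈ Finset.range n, M ((p ^ j) b) • (N ^ (n - 1 - j)) e‖
        ≤ ∑ j ∈ Finset.range n, η * (K * Real.exp (-c) ^ (n - 1 - j) * ‖e‖) := by
          refine norm_sum_le_of_le _ fun j hj => ?_
          rw [norm_smul]
          refine mul_le_mul (hη j (Finset.mem_range.1 hj)) ?_ (norm_nonneg _) hη0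
          rw [← hexp]
          exact (N ^ _).le_of_opNorm_le (hN _) e
      _ = η * (K * (∑ j ∈ Finset.range n, Real.exp (-c) ^ (n - 1 - j)) * ‖e‖) := by
          rw [← Finset.mul_sum, ← Finset.sum_mul, ← Finset.mul_sum]
      _ ≤ _ := by gcongr

end PowerBounds

/-! ### The central limit theorem contained in the invariance principle -/

section CLT

/-- Every increasing bijection of `[0,1]` fixes `1`, so time changes do not affect the endpoint and
evaluation there is 1-Lipschitz. -/
theorem SkorokhodSpace.continuous_eval_one : Continuous fun x : SkorokhodSpace => x 1 := by
  refine (LipschitzWith.of_edist_le (fun x y => ?_) : LipschitzWith 1 _).continuous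
  refine le_iInf fun τ => le_max_of_le_right ?_
  have h : τ 1 = 1 := τ.map_top
  have h2 := le_iSup (fun t => edist (x t) (y (τ t))) 1
  simpa only [h] using h2

variable {X : Type*} [MeasurableSpace X] {m : Measure X} [IsProbabilityMeasure m]
  {T : X → X} {φ : X → ℝ}

theorem measurable_ergodicSum (hT : Measurable T) (hφ : Measurable φ) (n : ℕ) :
    Measurable (ergodicSum T φ n) :=
  Finset.measurable_sum _ fun k _ => hφ.comp (hT.iterate k)

/-- At time `1` the invariance principle is a central limit theorem with variance `a²`, and `exp(-(a
s)²/2)` is below `η` for large `s`. The frequency is allowed to vary near `s₀` because `|t|√n` with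
integer `n` hits `s₀` only approximately. -/
theorem eventually_norm_integral_exp_le {Ω : Type*} [MeasurableSpace Ω] {Q : Measure Ω}
    [IsProbabilityMeasure Q] (hFIP : FunctionalInvariancePrinciple m T φ Q) {η : ℝ} (hη : 0 < η) :
    ∃ s₀ : ℝ, 0 < s₀ ∧ ∀ᶠ p : ℕ × ℝ in atTop ×ˢ 𝓝 s₀,
      ‖∫ x, Complex.exp (Complex.I * (p.2 * (ergodicSum T φ p.1 x / √p.1) : ℝ)) ∂m‖ ≤ η := by
  obtain ⟨W, a, w, hW, ha, hwW, hlim⟩ := hFIP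
  obtain ⟨s, hs1, hs0⟩ : ∃ s : ℝ, Real.exp (-(a * s) ^ 2 / 2) < η ∧ 0 < s := by
    have h : Tendsto (fun s : ℝ => Real.exp (-(a * s) ^ 2 / 2)) atTop (𝓝 0) := by
      refine Real.tendsto_exp_atBot.comp ?_
      have h1 : Tendsto (fun s : ℝ => (a * s) ^ 2) atTop atTop :=
        (tendsto_pow_atTop two_ne_zero).comp (tendsto_id.const_mul_atTop ha)
      have h2 := (tendsto_neg_atTop_atBot.comp h1).atBot_div_const (r := 2) (by norm_num)
      exact h2
    exact ((h.eventually (gt_mem_nhds hη)).and (eventually_gt_atTop 0)).exists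
  refine ⟨s, hs0, ?_⟩
  have h1 := hlim.continuous_comp SkorokhodSpace.continuous_eval_one
  have h2 : TendstoInDistribution
      (fun (p : ℕ × ℝ) x => ergodicSum T φ p.1 x / √p.1) (atTop ×ˢ 𝓝 s) (fun z => w z 1)
      (fun _ => m) Q := by
    have e : ∀ n, ((fun x : SkorokhodSpace => x 1) ∘ rescaledPath T φ n)
        = fun x => ergodicSum T φ n x / √n := by
      intro n; ext x; simp [rescaledPath]
    refine ⟨fun p => ?_, h1.aemeasurable_limit, ?_⟩
    · rw [← e]; exact h1.forall_aemeasurable p.1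
    · have h3 := h1.tendsto.comp (tendsto_fst (f := atTop) (g := 𝓝 s))
      refine h3.congr fun p => ?_
      refine Subtype.ext ?_
      exact congrArg (fun Y => m.map Y) (e p.1)
  -- Slutsky's lemma, with the varying frequency regarded as a constant random variable that tends
  -- to `s`.
  have h3 := h2.continuous_comp_prodMk_of_tendstoInMeasure_const (E' := ℝ) (c := s)
    (g := fun q : ℝ × ℝ => q.2 * q.1) (by fun_prop) (Y := fun p _ => p.2) ?_
    (fun _ => aemeasurable_const)
  swap
  · intro ε hε
    have : ∀ᶠ p : ℕ × ℝ in atTop ×ˢ 𝓝 s, edist p.2 s < ε :=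
      (tendsto_snd (f := atTop) (g := 𝓝 s)).eventually (Metric.eball_mem_nhds _ hε)
    refine tendsto_const_nhds.congr' ?_
    filter_upwards [this] with p hp
    simp [not_le.2 hp]
  have h4 := (ProbabilityMeasure.tendsto_iff_forall_integral_rclike_tendsto ℂ).1 h3.tendsto
    (BoundedContinuousFunction.innerProbChar 1)
  simp_rw [← charFun_eq_integral_innerProbChar] at h4
  have hlaw : charFun (Q.map fun z => s * w z 1) 1 = Complex.exp (-(a * s) ^ 2 / 2) := by
    have hl : (fun z => s * w z 1) =ᵐ[Q] fun z => (s * a) * W 1 z := by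
      filter_upwards [hwW] with z hz
      have : unitInterval.toNNReal 1 = 1 := by ext; simp
      rw [hz 1, this]; ring
    rw [Measure.map_congr hl]
    have hg := (hW.hasLaw_eval 1)
    have : Q.map (fun z => (s * a) * W 1 z) = (gaussianReal 0 1).map (fun y => (s * a) * y) := by
      rw [← hg.map_eq, AEMeasurable.map_map_of_aemeasurable (by fun_prop) hg.aemeasurable]; rfl
    rw [this, charFun_map_mul, charFun_gaussianReal]
    congr 1
    push_cast
    ring
  have h5 := h4.norm
  have h6 : ‖charFun (Q.map fun z => s * w z 1) 1‖ < η := by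
    rw [hlaw, Complex.norm_exp]
    convert hs1 using 2
    rw [← Complex.ofReal_re (-(a * s) ^ 2 / 2)]
    push_cast
    rfl
  filter_upwards [h5.eventually (gt_mem_nhds h6)] with p hp
  refine le_of_eq_of_le ?_ hp.le
  congr 1
  simp only [ProbabilityMeasure.coe_mk]
  rw [charFun_apply, integral_map (h3.forall_aemeasurable p) (by fun_prop)]
  refine integral_congr_ae (ae_of_all _ fun x => ?_)
  simp [mul_comm]

end CLT

/-! ### Characteristic functions through the operators `P t` -/

section Duality

variable {X : Type*} [MeasurableSpace X] {m : Measure X} [IsProbabilityMeasure m]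
  {T : X → X} {φ : X → ℝ}
  {B : Type*} [NormedAddCommGroup B] [NormedSpace ℂ B]

theorem Lp_top_integrable (g : Lp ℂ ∞ m) : Integrable g m :=
  (Lp.memLp g).integrable le_top

theorem Lp_top_ae_norm_le {Y : Type*} [MeasurableSpace Y] {m : Measure Y} (g : Lp ℂ ∞ m) : ∀ᵐ x ∂m, ‖g x‖ ≤ ‖g‖ := by
  filter_upwards [enorm_ae_le_eLpNormEssSup g m] with x hx
  rw [Lp.norm_def, eLpNorm_exponent_top]
  have := ENNReal.toReal_mono (by
    have := Lp.eLpNorm_ne_top g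
    rwa [eLpNorm_exponent_top] at this) hx
  simpa using this

/-- The functional `b ↦ ∫ b dm` on a Banach space presented inside `L^∞(m)`. -/
noncomputable def massFunctional (ι : B →L[ℂ] Lp ℂ ∞ m) : B →L[ℂ] ℂ :=
  LinearMap.mkContinuous
    { toFun := fun b => ∫ x, ι b x ∂m
      map_add' := fun a b => by
        rw [map_add, ← integral_add (Lp_top_integrable _) (Lp_top_integrable _)]
        exact integral_congr_ae (Lp.coeFn_add _ _)
      map_smul' := fun c b => by
        rw [map_smul, RingHom.id_apply, smul_eq_mul, ← integral_const_mul]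
        exact integral_congr_ae (Lp.coeFn_smul _ _) }
    ‖ι‖ fun b => by
      have h := norm_integral_le_of_norm_le_const (Lp_top_ae_norm_le (ι b))
      simp only [probReal_univ, mul_one] at h
      exact h.trans (ι.le_opNorm b)

theorem massFunctional_apply (ι : B →L[ℂ] Lp ℂ ∞ m) (b : B) :
    massFunctional ι b = ∫ x, ι b x ∂m := rfl

theorem ergodicSum_succ {Y : Type*} {T : Y → Y} {φ : Y → ℝ} (n : ℕ) (x : Y) :
    ergodicSum T φ (n + 1) x = φ x + ergodicSum T φ n (T x) := by
  simp only [ergodicSum, Finset.sum_range_succ', Function.iterate_succ_apply,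
    Function.iterate_zero_apply]
  ring

theorem ergodicSum_add {Y : Type*} {T : Y → Y} {φ : Y → ℝ} (a n : ℕ) (x : Y) :
    ergodicSum T φ (a + n) x = ergodicSum T φ a x + ergodicSum T φ n (T^[a] x) := by
  simp only [ergodicSum, Finset.sum_range_add]
  congr 1
  refine Finset.sum_congr rfl fun k _ => ?_
  rw [add_comm a k, Function.iterate_add_apply]

theorem norm_exp_I_mul_mul (s y : ℝ) : ‖Complex.exp (Complex.I * s * y)‖ = 1 := by
  have : Complex.I * s * y = ((s * y : ℝ) : ℂ) * Complex.I := by push_cast; ring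
  rw [this, Complex.norm_exp_ofReal_mul_I]

/-- Iterated duality: `∫ (P(t)^l b) v dm = ∫ e^{itS_l} b (v ∘ T^l) dm`. -/
theorem integral_pow_mul (hT : MeasurePreserving T m m) (hφ : Measurable φ)
    {ι : B →L[ℂ] Lp ℂ ∞ m} {P : ℝ → B →L[ℂ] B} (hP : RestrictsTo T φ ι P) (t : ℝ) (l : ℕ) (b : B)
    {v : X → ℂ} (hv : Measurable v) {K : ℝ} (hK : ∀ x, ‖v x‖ ≤ K) :
    ∫ x, ι ((P t ^ l) b) x * v x ∂m
      = ∫ x, ι b x * (Complex.exp (Complex.I * t * ergodicSum T φ l x) * v (T^[l] x)) ∂m := by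
  induction l generalizing b with
  | zero => simp [ergodicSum]
  | succ l ih =>
    have hpow : (P t ^ (l + 1)) b = (P t ^ l) (P t b) := by rw [pow_succ]; rfl
    rw [hpow, ih]
    have hS := measurable_ergodicSum hT.measurable hφ l
    have hw : Measurable fun x =>
        Complex.exp (Complex.I * t * ergodicSum T φ l x) * v (T^[l] x) := by
      exact Measurable.mul (by fun_prop) (hv.comp (hT.measurable.iterate l))
    have hint : Integrable (fun x => Complex.exp (Complex.I * t * φ x) * ι b x) m := by
      refine (Lp_top_integrable (ι b)).bdd_mul (c := 1) ?_ (ae_of_all _ fun x => ?_)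
      · exact Measurable.aestronglyMeasurable (by fun_prop)
      · rw [norm_exp_I_mul_mul]
    have hKw : ∀ x, ‖Complex.exp (Complex.I * t * ergodicSum T φ l x) * v (T^[l] x)‖ ≤ K := by
      intro x
      rw [norm_mul, norm_exp_I_mul_mul, one_mul]
      exact hK _
    -- One use of duality; `S_{l+1} = φ + S_l ∘ T` then merges the new phase with the phase of the
    -- induction hypothesis.
    have h1 := integral_transferFun_mul hT hint hw hKw
    rw [integral_congr_ae (g := fun x => transferFun m T
      (fun x => Complex.exp (Complex.I * t * φ x) * ι b x) x *
      (Complex.exp (Complex.I * t * ergodicSum T φ l x) * v (T^[l] x)))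
      (by filter_upwards [hP t b] with x hx; rw [hx]; rfl), h1]
    refine integral_congr_ae (ae_of_all _ fun x => ?_)
    simp only [ergodicSum_succ, Function.iterate_succ_apply]
    push_cast
    rw [mul_add, Complex.exp_add]
    ring

theorem massFunctional_pow (hT : MeasurePreserving T m m) (hφ : Measurable φ)
    {ι : B →L[ℂ] Lp ℂ ∞ m} {P : ℝ → B →L[ℂ] B} (hP : RestrictsTo T φ ι P) (t : ℝ) (l : ℕ) (b : B) :
    massFunctional ι ((P t ^ l) b)
      = ∫ x, ι b x * Complex.exp (Complex.I * t * ergodicSum T φ l x) ∂m := by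
  have h := integral_pow_mul hT hφ hP t l b (v := fun _ => 1) measurable_const (K := 1)
    (fun _ => by simp)
  simpa [massFunctional_apply] using h

/-- The phase has modulus one, so the bound is uniform in `t` and `l`. It is the a priori estimate
that makes the powers of `P t` bounded near `0`. -/
theorem norm_massFunctional_pow_le (hT : MeasurePreserving T m m) (hφ : Measurable φ)
    {ι : B →L[ℂ] Lp ℂ ∞ m} {P : ℝ → B →L[ℂ] B} (hP : RestrictsTo T φ ι P) (t : ℝ) (l : ℕ) (b : B) :
    ‖massFunctional ι ((P t ^ l) b)‖ ≤ ‖ι‖ * ‖b‖ := by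
  rw [massFunctional_pow hT hφ hP]
  have h := norm_integral_le_of_norm_le_const (μ := m)
    (f := fun x => ι b x * Complex.exp (Complex.I * t * ergodicSum T φ l x)) (C := ‖ι b‖) (by
      filter_upwards [Lp_top_ae_norm_le (ι b)] with x hx
      rwa [norm_mul, norm_exp_I_mul_mul, mul_one])
  simp only [probReal_univ, mul_one] at h
  exact h.trans (ι.le_opNorm b)

theorem transferFun_one (hT : MeasurePreserving T m m) :
    transferFun m T (fun _ => 1) =ᵐ[m] fun _ => 1 := by
  refine (integrable_transferFun m T _).ae_eq_of_forall_setIntegral_eq _ _ (integrable_const _)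
    fun s hs _ => ?_
  rw [setIntegral_transferFun hT (integrable_const _) hs]
  simp [measureReal_def, hT.measure_preimage hs.nullMeasurableSet]

theorem transferFun_congr {Y : Type*} [MeasurableSpace Y] {m : Measure Y} {T : Y → Y} {f g : Y → ℂ}
    (h : f =ᵐ[m] g) : transferFun m T f = transferFun m T g := by
  unfold transferFun
  rw [WithDensityᵥEq.congr_ae h]

theorem restrictsTo_zero_apply_one (hT : MeasurePreserving T m m)
    {ι : B →L[ℂ] Lp ℂ ∞ m} (hι : Function.Injective ι) {P : ℝ → B →L[ℂ] B}
    (hP : RestrictsTo T φ ι P) {e : B} (he : ι e =ᵐ[m] fun _ => 1) : P 0 e = e := by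
  refine hι (Lp.ext ?_)
  filter_upwards [hP 0 e, transferFun_one hT, he] with x h1 h2 h3
  have h4 : charFunOp m T φ 0 (ι e) = transferFun m T fun _ => 1 := by
    refine transferFun_congr ?_
    filter_upwards [he] with y hy
    simp [hy]
  rw [h1, h3, h4, h2]

end Duality

/-! ### Gaussian bounds for the powers of `P t` -/

section SpectralBounds

variable {X : Type*} [MeasurableSpace X] {m : Measure X} [IsProbabilityMeasure m]
  {T : X → X} {φ : X → ℝ}

theorem norm_integral_exp_I_neg {Y : Type*} [MeasurableSpace Y] {m : Measure Y} (t : ℝ) (S : Y → ℝ) :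
    ‖∫ x, Complex.exp (Complex.I * (-t : ℝ) * S x) ∂m‖
      = ‖∫ x, Complex.exp (Complex.I * t * S x) ∂m‖ := by
  rw [← RCLike.norm_conj, ← integral_conj]
  congr 1
  refine integral_congr_ae (ae_of_all _ fun x => ?_)
  simp [← Complex.exp_conj]

/-- With `n = ⌈(s₀/t)²⌉` the phase `|t| S_n` equals `(|t|√n)(S_n/√n)`, and `|t|√n` lies between `s₀`
and `√(s₀² + t²)`. The sign of `t` only conjugates the integral. -/
theorem eventually_norm_integral_exp_ceil_le {Ω : Type*} [MeasurableSpace Ω] {Q : Measure Ω}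
    [IsProbabilityMeasure Q] (hFIP : FunctionalInvariancePrinciple m T φ Q) {η : ℝ} (hη : 0 < η) :
    ∃ s₀ : ℝ, 0 < s₀ ∧ ∀ᶠ t : ℝ in 𝓝[≠] 0,
      ‖∫ x, Complex.exp (Complex.I * t * ergodicSum T φ ⌈(s₀ / t) ^ 2⌉₊ x) ∂m‖ ≤ η := by
  obtain ⟨s, hs, hev⟩ := eventually_norm_integral_exp_le hFIP hη
  refine ⟨s, hs, ?_⟩
  have hn : Tendsto (fun t : ℝ => ⌈(s / t) ^ 2⌉₊) (𝓝[≠] 0) atTop := by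
    refine tendsto_nat_ceil_atTop.comp ?_
    have h1 : Tendsto (fun t : ℝ => (t ^ 2)⁻¹) (𝓝[≠] 0) atTop := by
      refine tendsto_inv_nhdsGT_zero.comp (tendsto_nhdsWithin_iff.2 ⟨?_, ?_⟩)
      · have : Tendsto (fun t : ℝ => t ^ 2) (𝓝 0) (𝓝 (0 ^ 2)) := (continuous_pow 2).tendsto 0
        rw [zero_pow two_ne_zero] at this
        exact this.mono_left nhdsWithin_le_nhds
      · filter_upwards [self_mem_nhdsWithin] with t ht
        exact pow_pos (abs_pos.2 ht) 2 |>.trans_eq (sq_abs t)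
    refine (h1.const_mul_atTop (pow_pos hs 2)).congr fun t => ?_
    rw [div_pow]; rfl
  have hc : Tendsto (fun t : ℝ => |t| * √(⌈(s / t) ^ 2⌉₊ : ℕ)) (𝓝[≠] 0) (𝓝 s) := by
    have hu : Tendsto (fun t : ℝ => √(s ^ 2 + t ^ 2)) (𝓝[≠] 0) (𝓝 s) := by
      have h1 : Continuous fun t : ℝ => √(s ^ 2 + t ^ 2) := by fun_prop
      have h2 := h1.tendsto 0
      rw [zero_pow two_ne_zero, add_zero, Real.sqrt_sq hs.le] at h2
      exact h2.mono_left nhdsWithin_le_nhds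
    refine tendsto_of_tendsto_of_tendsto_of_le_of_le' tendsto_const_nhds hu ?_ ?_
    · filter_upwards [self_mem_nhdsWithin] with t ht
      have ht' : 0 < |t| := abs_pos.2 ht
      have h1 := Nat.le_ceil ((s / t) ^ 2)
      have h2 := Real.sqrt_le_sqrt h1
      rw [Real.sqrt_sq_eq_abs, abs_div, abs_of_pos hs, div_le_iff₀ ht'] at h2
      linarith
    · filter_upwards [self_mem_nhdsWithin] with t ht
      have ht' : t ≠ 0 := ht
      refine Real.le_sqrt_of_sq_le ?_
      rw [mul_pow, sq_abs, Real.sq_sqrt (Nat.cast_nonneg _)]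
      have h1 := (Nat.ceil_lt_add_one (sq_nonneg (s / t))).le
      calc t ^ 2 * (⌈(s / t) ^ 2⌉₊ : ℕ) ≤ t ^ 2 * ((s / t) ^ 2 + 1) := by gcongr
        _ = s ^ 2 + t ^ 2 := by field_simp
  filter_upwards [(hn.prodMk hc).eventually hev, hn.eventually (eventually_gt_atTop 0)]
    with t ht hnt
  have hsq : (0 : ℝ) < √(⌈(s / t) ^ 2⌉₊ : ℕ) := Real.sqrt_pos.2 (by exact_mod_cast hnt)
  have key : ‖∫ x, Complex.exp (Complex.I * (|t| : ℝ) * ergodicSum T φ ⌈(s / t) ^ 2⌉₊ x) ∂m‖ ≤ η := by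
    refine le_of_eq_of_le ?_ ht
    congr 1
    refine integral_congr_ae (ae_of_all _ fun x => ?_)
    simp only
    congr 1
    rw [mul_assoc]
    congr 1
    rw [← Complex.ofReal_mul]
    congr 1
    rw [mul_assoc, mul_div_cancel₀ _ hsq.ne']
  rcases abs_choice t with h | h
  · rwa [h] at key
  · rwa [h, norm_integral_exp_I_neg] at key

variable {B : Type*} [NormedAddCommGroup B] [NormedSpace ℂ B] [CompleteSpace B]

/-- The powers of `P t` obey a Gaussian bound near `t = 0`. -/
theorem eventually_norm_pow_le_gaussian_zero (hT : MeasurePreserving T m m) (hφ : Measurable φ)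
    {ι : B →L[ℂ] Lp ℂ ∞ m} (hι : IsBanachFunctionSpace ι)
    {P : ℝ → B →L[ℂ] B} (hP : RestrictsTo T φ ι P)
    (hquasi : IsQuasiCompactTransfer ι P) (hcont : Continuous P)
    {Ω : Type*} [MeasurableSpace Ω] {Q : Measure Ω} [IsProbabilityMeasure Q]
    (hFIP : FunctionalInvariancePrinciple m T φ Q) :
    ∃ K c : ℝ, 0 < K ∧ 0 < c ∧
      ∀ᶠ t in 𝓝 (0 : ℝ), ∀ k : ℕ, ‖P t ^ k‖ ≤ K * Real.exp (-c * t ^ 2 * k) := by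
  obtain ⟨e, he⟩ := hι.one_mem
  obtain ⟨N, hN, hρ⟩ := hquasi
  set M := massFunctional ι with hM
  have hMe : M e = 1 := by
    rw [hM, massFunctional_apply, integral_congr_ae he]; simp
  have hdec : ∀ b, P 0 b = M b • e + N b := by
    intro b
    refine hι.injective (Lp.ext ?_)
    rw [map_add, map_smul]
    filter_upwards [hN b, Lp.coeFn_add (M b • ι e) (ι (N b)), Lp.coeFn_smul (M b) (ι e), he]
      with x h1 h2 h3 h4
    rw [h1, h2, Pi.add_apply, h3, Pi.smul_apply, h4, smul_eq_mul, mul_one]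
    rfl
  -- The whole perturbation is put into `N`, so `M` and `e` do not depend on `t`, and the perturbed
  -- `N` keeps decaying powers.
  have hp : ∀ t b, P t b = M b • e + (N + (P t - P 0)) b := by
    intro t b
    simp only [add_apply, sub_apply]
    rw [← add_assoc, ← hdec]; abel
  obtain ⟨K₁, c₁, hK₁, hc₁, hev₁⟩ := eventually_norm_pow_le_exp hρ
  have hNt : ∀ᶠ t in 𝓝 (0 : ℝ), ∀ k : ℕ, ‖(N + (P t - P 0)) ^ k‖ ≤ K₁ * Real.exp (-c₁ * k) := by
    have h1 : Continuous fun t => N + (P t - P 0) := by fun_prop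
    have h2 := h1.tendsto 0
    rw [sub_self, add_zero] at h2
    exact h2.eventually hev₁
  have hN₁ : ∀ k : ℕ, ‖N ^ k‖ ≤ K₁ * Real.exp (-c₁ * k) := by
    have := hNt.self_of_nhds
    simpa using this
  set D := K₁ * (1 - Real.exp (-c₁))⁻¹ * ‖e‖ with hD
  have hD0 : 0 ≤ D := by
    have : Real.exp (-c₁) < 1 := Real.exp_lt_one_iff.2 (by linarith)
    have : 0 < 1 - Real.exp (-c₁) := by linarith
    positivity
  set K := K₁ + ‖ι‖ * D with hKdef
  have hK : 0 < K := by positivity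
  have hbd : ∀ t : ℝ, (∀ k : ℕ, ‖(N + (P t - P 0)) ^ k‖ ≤ K₁ * Real.exp (-c₁ * k)) →
      ∀ (k : ℕ) (b : B), ‖(P t ^ k) b‖ ≤ K * ‖b‖ := by
    intro t ht k b
    refine (norm_pow_apply_le_of_rankOne_add (hp t) hK₁ hc₁ ht k b
      (fun j _ => norm_massFunctional_pow_le hT hφ hP t j b) (by positivity)).trans ?_
    have : Real.exp (-c₁ * k) ≤ 1 := Real.exp_le_one_iff.2 (by
      have : 0 ≤ c₁ * k := by positivity
      linarith)
    calc K₁ * Real.exp (-c₁ * k) * ‖b‖ + ‖ι‖ * ‖b‖ * D ≤ K₁ * 1 * ‖b‖ + ‖ι‖ * ‖b‖ * D := by gcongr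
      _ = K * ‖b‖ := by rw [hKdef]; ring
  have hP0e : P 0 e = e := restrictsTo_zero_apply_one hT hι.injective hP he
  have hMP0 : ∀ (r : ℕ) b, M ((P 0 ^ r) b) = M b := by
    intro r b
    rw [hM, massFunctional_pow hT hφ hP, massFunctional_apply]
    simp
  -- `M` is invariant under `P 0`, hence vanishes on the range of `N ^ (r + 1)`, so no cross terms
  -- appear.
  have hP0pow : ∀ (r : ℕ) b, (P 0 ^ (r + 1)) b = M b • e + (N ^ (r + 1)) b := by
    intro r b
    induction r with
    | zero => simpa using hdec b
    | succ r ih =>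
      have h0 : M ((N ^ (r + 1)) b) = 0 := by
        have h1 := hMP0 (r + 1) b
        rw [ih, map_add, map_smul, hMe, smul_eq_mul, mul_one] at h1
        simpa using h1
      have h1 : (P 0 ^ (r + 1 + 1)) b = P 0 ((P 0 ^ (r + 1)) b) := by rw [pow_succ']; rfl
      have h2 : (N ^ (r + 1 + 1)) b = N ((N ^ (r + 1)) b) := by rw [pow_succ']; rfl
      rw [h1, ih, map_add, map_smul, hP0e, hdec ((N ^ (r + 1)) b), h0, zero_smul, zero_add, h2]
  have hexp0 : Tendsto (fun k : ℕ => Real.exp (-c₁ * k)) atTop (𝓝 0) := by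
    refine Real.tendsto_exp_atBot.comp ?_
    exact tendsto_natCast_atTop_atTop.const_mul_atTop_of_neg (by linarith)
  -- Chosen so that the rank one contribution `3 η ‖ι‖ K D` to the final contraction is at most
  -- `1/4`; the choice of `q` below makes the other contribution at most `1/4`.
  set η := 1 / (12 * (K * D * ‖ι‖ + 1)) with hη
  have hη0 : 0 < η := by positivity
  have hηK : 3 * η * ‖ι‖ * K * D ≤ 1 / 4 := by
    have h1 : η * (12 * (K * D * ‖ι‖ + 1)) = 1 := by rw [hη]; field_simp
    nlinarith
  -- The exponent is `r + 1` because the decomposition in `hP0pow` fails for the zeroth power.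
  obtain ⟨r, hr⟩ : ∃ r : ℕ, K₁ * Real.exp (-c₁ * (r + 1 : ℕ)) ≤ η := by
    have h1 := (hexp0.const_mul K₁).comp (tendsto_add_atTop_nat 1)
    rw [mul_zero] at h1
    exact (h1.eventually (ge_mem_nhds hη0)).exists
  obtain ⟨q, hq⟩ : ∃ q : ℕ, K₁ * Real.exp (-c₁ * q) * K ≤ 1 / 4 := by
    have h1 := (hexp0.const_mul K₁).mul_const K
    rw [mul_zero, zero_mul] at h1
    exact (h1.eventually (ge_mem_nhds (by norm_num))).exists
  obtain ⟨s, hs, hsev⟩ := eventually_norm_integral_exp_ceil_le hFIP hη0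
  have hPr : ∀ᶠ t in 𝓝 (0 : ℝ), ‖P t ^ (r + 1) - P 0 ^ (r + 1)‖ ≤ η := by
    have h1 : Continuous fun t => ‖P t ^ (r + 1) - P 0 ^ (r + 1)‖ := by fun_prop
    have h2 := h1.tendsto 0
    rw [sub_self, norm_zero] at h2
    exact h2.eventually (ge_mem_nhds hη0)
  have hsmall : ∀ᶠ t in 𝓝 (0 : ℝ), |t| ≤ 1 := by
    have h2 := continuous_abs.tendsto (0 : ℝ)
    rw [abs_zero] at h2
    exact h2.eventually (ge_mem_nhds one_pos)
  -- Bounds `L t²` for `|t| ≤ 1`, where `L = n + (r + 1) + q` is the contracting exponent and `n <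
  -- (s/t)² + 1`.
  set R : ℝ := s ^ 2 + 1 + (r + 1 + q) with hR
  have hR0 : 0 < R := by positivity
  refine ⟨2 * K, Real.log 2 / R, by positivity, div_pos (Real.log_pos one_lt_two) hR0, ?_⟩
  filter_upwards [hNt, hPr, hsmall, eventually_nhdsWithin_iff.1 hsev] with t ht1 ht2 ht3 ht4 k
  have hb := hbd t ht1
  have hKop : ∀ j : ℕ, ‖P t ^ j‖ ≤ K := fun j =>
    ContinuousLinearMap.opNorm_le_bound _ hK.le (hb j)
  rcases eq_or_ne t 0 with rfl | ht0
  · simp only [ne_eq, OfNat.ofNat_ne_zero, not_false_eq_true, zero_pow, mul_zero, zero_mul,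
      Real.exp_zero, mul_one]
    linarith [hKop k]
  have ht4 := ht4 ht0
  set n := ⌈(s / t) ^ 2⌉₊ with hn
  have hMe' : ‖M ((P t ^ n) e)‖ ≤ η := by
    rw [hM, massFunctional_pow hT hφ hP]
    refine le_of_eq_of_le ?_ ht4
    congr 1
    refine integral_congr_ae ?_
    filter_upwards [he] with x hx
    rw [hx, one_mul]
  -- After `r + 1` steps a vector is `M b • e` up to an error `2 η ‖b‖`. The next `n` steps make the
  -- mass of the `e` part small by the central limit theorem, and the error is only carried along.
  have hcontr : ∀ b, ‖M ((P t ^ n) ((P t ^ (r + 1)) b))‖ ≤ 3 * η * ‖ι‖ * ‖b‖ := by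
    intro b
    set d := (P t ^ (r + 1)) b - M b • e with hd
    have hdn : ‖d‖ ≤ 2 * η * ‖b‖ := by
      have h1 : d = (P t ^ (r + 1) - P 0 ^ (r + 1)) b + (N ^ (r + 1)) b := by
        rw [hd, sub_apply, hP0pow]; abel
      rw [h1]
      refine (norm_add_le _ _).trans ?_
      have h2 := ContinuousLinearMap.le_of_opNorm_le _ ht2 b
      have h3 := ContinuousLinearMap.le_of_opNorm_le _ ((hN₁ (r + 1)).trans hr) b
      linarith
    have h1 : (P t ^ (r + 1)) b = M b • e + d := by rw [hd]; abel
    rw [h1, map_add, map_smul, map_add, map_smul]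
    refine (norm_add_le _ _).trans ?_
    rw [norm_smul]
    have h2 : ‖M b‖ ≤ ‖ι‖ * ‖b‖ := by
      simpa using norm_massFunctional_pow_le hT hφ hP t 0 b
    have h3 := norm_massFunctional_pow_le hT hφ hP t n d
    have h4 : ‖M b‖ * ‖M ((P t ^ n) e)‖ ≤ ‖ι‖ * ‖b‖ * η := by gcongr
    have h5 : ‖ι‖ * ‖d‖ ≤ ‖ι‖ * (2 * η * ‖b‖) := by gcongr
    linarith
  -- `hcontr` controls only a functional; `q` further steps of the rank one formula turn this into a
  -- bound in norm.
  have hhalf : ‖P t ^ (n + (r + 1) + q)‖ ≤ 1 / 2 := by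
    refine ContinuousLinearMap.opNorm_le_bound _ (by norm_num) fun b => ?_
    have h1 : (P t ^ (n + (r + 1) + q)) b = (P t ^ q) ((P t ^ (n + (r + 1))) b) := by
      rw [add_comm, pow_add]; rfl
    rw [h1]
    refine (norm_pow_apply_le_of_rankOne_add (hp t) hK₁ hc₁ ht1 q _
      (η := 3 * η * ‖ι‖ * (K * ‖b‖)) (fun j _ => ?_) (by positivity)).trans ?_
    -- Powers of `P t` commute, so the extra `j` steps can be taken first and `hcontr` applies to
    -- their result.
    · have h2 : (P t ^ j) ((P t ^ (n + (r + 1))) b)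
          = (P t ^ n) ((P t ^ (r + 1)) ((P t ^ j) b)) := by
        change (P t ^ j * P t ^ (n + (r + 1))) b = (P t ^ n * (P t ^ (r + 1) * P t ^ j)) b
        rw [← pow_add, ← pow_add, ← pow_add]
        congr 2; omega
      rw [h2]
      refine (hcontr _).trans ?_
      gcongr
      exact hb j b
    · have h3 := hb (n + (r + 1)) b
      calc K₁ * Real.exp (-c₁ * q) * ‖(P t ^ (n + (r + 1))) b‖ + 3 * η * ‖ι‖ * (K * ‖b‖) * D
          ≤ K₁ * Real.exp (-c₁ * q) * (K * ‖b‖) + 3 * η * ‖ι‖ * (K * ‖b‖) * D := by gcongr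
        _ = (K₁ * Real.exp (-c₁ * q) * K + 3 * η * ‖ι‖ * K * D) * ‖b‖ := by ring
        _ ≤ (1 / 4 + 1 / 4) * ‖b‖ := by gcongr
        _ = 1 / 2 * ‖b‖ := by ring
  have h := norm_pow_le_exp_of_norm_pow_le_half (by omega) hhalf (fun j _ => hKop j) k
  refine h.trans ?_
  have hL0 : (0 : ℝ) < (n + (r + 1) + q : ℕ) := by positivity
  have hLR : ((n + (r + 1) + q : ℕ) : ℝ) * t ^ 2 ≤ R := by
    have h1 := (Nat.ceil_lt_add_one (sq_nonneg (s / t))).le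
    have h2 : t ^ 2 ≤ 1 := by rw [← sq_abs]; exact pow_le_one₀ (abs_nonneg _) ht3
    have h3 : (s / t) ^ 2 * t ^ 2 = s ^ 2 := by field_simp
    push_cast
    calc ((n : ℝ) + (r + 1) + q) * t ^ 2 ≤ ((s / t) ^ 2 + 1 + (r + 1) + q) * t ^ 2 := by gcongr
      _ = s ^ 2 + (1 + (r + 1) + q) * t ^ 2 := by rw [← h3]; ring
      _ ≤ s ^ 2 + (1 + (r + 1) + q) * 1 := by gcongr
      _ = R := by rw [hR]; ring
  have hrate : Real.log 2 / R * t ^ 2 ≤ Real.log 2 / (n + (r + 1) + q : ℕ) := by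
    rw [div_mul_eq_mul_div, div_le_div_iff₀ hR0 hL0]
    have := mul_le_mul_of_nonneg_left hLR (Real.log_nonneg one_le_two)
    linarith
  have hk : (0 : ℝ) ≤ k := Nat.cast_nonneg k
  gcongr
  have := mul_le_mul_of_nonneg_right hrate hk
  linarith

/-- The powers of `P t` obey a Gaussian bound, uniformly on compact sets of `t`. -/
theorem exists_norm_pow_le_gaussian (hT : MeasurePreserving T m m) (hφ : Measurable φ)
    {ι : B →L[ℂ] Lp ℂ ∞ m} (hι : IsBanachFunctionSpace ι)
    {P : ℝ → B →L[ℂ] B} (hP : RestrictsTo T φ ι P)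
    (hquasi : IsQuasiCompactTransfer ι P) (hcont : Continuous P) (haper : IsAperiodicFamily P)
    {Ω : Type*} [MeasurableSpace Ω] {Q : Measure Ω} [IsProbabilityMeasure Q]
    (hFIP : FunctionalInvariancePrinciple m T φ Q) {s : Set ℝ} (hs : IsCompact s) :
    ∃ K c : ℝ, 0 < K ∧ 0 < c ∧
      ∀ t ∈ s, ∀ k : ℕ, ‖P t ^ k‖ ≤ K * Real.exp (-c * t ^ 2 * k) := by
  refine hs.induction_on (p := fun s => ∃ K c : ℝ, 0 < K ∧ 0 < c ∧
      ∀ t ∈ s, ∀ k : ℕ, ‖P t ^ k‖ ≤ K * Real.exp (-c * t ^ 2 * k)) ?_ ?_ ?_ ?_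
  · exact ⟨1, 1, one_pos, one_pos, by simp⟩
  · rintro u v huv ⟨K, c, hK, hc, h⟩
    exact ⟨K, c, hK, hc, fun t ht => h t (huv ht)⟩
  · rintro u v ⟨K, c, hK, hc, h⟩ ⟨K', c', hK', hc', h'⟩
    have mono : ∀ {A a : ℝ}, A ≤ max K K' → min c c' ≤ a → 0 < A → ∀ (t : ℝ) (k : ℕ),
        A * Real.exp (-a * t ^ 2 * k) ≤ max K K' * Real.exp (-min c c' * t ^ 2 * k) := by
      intro A a hA ha hA0 t k
      have : 0 ≤ t ^ 2 * k := by positivity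
      refine mul_le_mul hA (Real.exp_le_exp.2 ?_) (Real.exp_pos _).le (by positivity)
      nlinarith
    refine ⟨max K K', min c c', by positivity, by positivity, fun t ht k => ?_⟩
    rcases ht with ht | ht
    · exact (h t ht k).trans (mono (le_max_left _ _) (min_le_left _ _) hK t k)
    · exact (h' t ht k).trans (mono (le_max_right _ _) (min_le_right _ _) hK' t k)
  · intro t₀ _
    suffices h : ∃ K c : ℝ, 0 < K ∧ 0 < c ∧
        ∀ᶠ t in 𝓝 t₀, ∀ k : ℕ, ‖P t ^ k‖ ≤ K * Real.exp (-c * t ^ 2 * k) by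
      obtain ⟨K, c, hK, hc, h⟩ := h
      exact ⟨_, mem_nhdsWithin_of_mem_nhds h, K, c, hK, hc, fun t ht => ht⟩
    rcases eq_or_ne t₀ 0 with rfl | ht₀
    · exact eventually_norm_pow_le_gaussian_zero hT hφ hι hP hquasi hcont hFIP
    obtain ⟨K, c, hK, hc, h⟩ := eventually_norm_pow_le_exp (haper t₀ ht₀)
    -- Near `t₀ ≠ 0` the decay rate is a constant `c`; the division makes the Gaussian rate at most
    -- `c` wherever `t² ≤ t₀² + 1`.
    refine ⟨K, c / (t₀ ^ 2 + 1), hK, by positivity, ?_⟩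
    have h1 : ∀ᶠ t in 𝓝 t₀, t ^ 2 ≤ t₀ ^ 2 + 1 :=
      ((continuous_pow 2).tendsto t₀).eventually (ge_mem_nhds (lt_add_one _))
    filter_upwards [(hcont.tendsto t₀).eventually h, h1] with t ht1 ht2 k
    refine (ht1 k).trans ?_
    have h3 : c / (t₀ ^ 2 + 1) * t ^ 2 ≤ c := by
      rw [div_mul_eq_mul_div, div_le_iff₀ (by positivity)]
      gcongr
    have hk : (0 : ℝ) ≤ k := Nat.cast_nonneg k
    gcongr
    have := mul_le_mul_of_nonneg_right h3 hk
    linarith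

end SpectralBounds

/-! ### A four-fold convolution-type integral -/

section ChainIntegral

/-- Only this inequality is needed to bring sums inside the iterated integrals, and it requires no
measurability. -/
theorem finset_sum_lintegral_le {α κ : Type*} [MeasurableSpace α] (μ : Measure α) (s : Finset κ)
    (f : κ → α → ℝ≥0∞) : ∑ i ∈ s, ∫⁻ x, f i x ∂μ ≤ ∫⁻ x, ∑ i ∈ s, f i x ∂μ := by
  classical
  induction s using Finset.induction_on with
  | empty => simp
  | insert i s hi ih =>
    simp only [Finset.sum_insert hi]
    exact (add_le_add_right ih _).trans (le_lintegral_add _ _)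

variable {G ψ : ℝ → ℝ≥0∞} {a d : ℝ≥0∞}

/-- Substitute `u = t + s` and split `ψ (u - s)`. Here `a * a` bounds the mass of `G`, and every
factor `ψ` under the integral trades an `a` for a `d`. -/
theorem lintegral_chain_first_le (hG : Measurable G) (hψ : Measurable ψ)
    (h0 : ∫⁻ u, G u ≤ a * a) (h1 : ∫⁻ u, ψ u * G u ≤ a * d)
    (hsub : ∀ u s, ψ (u - s) ≤ ψ u + ψ s) (s : ℝ) :
    ∫⁻ t, ψ t * G (t + s) ≤ a * (d + ψ s * a) := by
  calc ∫⁻ t, ψ t * G (t + s) = ∫⁻ u, ψ (u - s) * G u := by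
        rw [← lintegral_add_right_eq_self (fun u => ψ (u - s) * G u) s]
        simp
    _ ≤ ∫⁻ u, (ψ u * G u + ψ s * G u) := by
        refine lintegral_mono fun u => ?_
        rw [← add_mul]
        gcongr
        exact hsub u s
    _ = (∫⁻ u, ψ u * G u) + ψ s * ∫⁻ u, G u := by
        rw [lintegral_add_left (by fun_prop), lintegral_const_mul _ hG]
    _ ≤ a * d + ψ s * (a * a) := by gcongr
    _ = _ := by ring

/-- The weight `d + ψ · a` left by one integration reproduces itself under the next, at the cost of
a factor `2 * a * d`; this allows the integrals to be done successively. -/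
theorem lintegral_chain_step_le (hG : Measurable G) (hψ : Measurable ψ)
    (h0 : ∫⁻ u, G u ≤ a * a) (h1 : ∫⁻ u, ψ u * G u ≤ a * d) (h2 : ∫⁻ u, ψ u ^ 2 * G u ≤ d * d)
    (hsub : ∀ u s, ψ (u - s) ≤ ψ u + ψ s) (s : ℝ) :
    ∫⁻ t, ψ t * G (t + s) * (d + ψ (t + s) * a) ≤ 2 * a * d * (d + ψ s * a) := by
  calc ∫⁻ t, ψ t * G (t + s) * (d + ψ (t + s) * a)
      = ∫⁻ u, ψ (u - s) * G u * (d + ψ u * a) := by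
        rw [← lintegral_add_right_eq_self (fun u => ψ (u - s) * G u * (d + ψ u * a)) s]
        simp
    _ ≤ ∫⁻ u, (d * (ψ u * G u) + (a * (ψ u ^ 2 * G u)
          + (ψ s * d * G u + ψ s * a * (ψ u * G u)))) := by
        refine lintegral_mono fun u => ?_
        calc ψ (u - s) * G u * (d + ψ u * a) ≤ (ψ u + ψ s) * G u * (d + ψ u * a) := by
              gcongr
              exact hsub u s
          _ = _ := by ring
    _ = d * (∫⁻ u, ψ u * G u) + (a * (∫⁻ u, ψ u ^ 2 * G u)
          + (ψ s * d * (∫⁻ u, G u) + ψ s * a * ∫⁻ u, ψ u * G u)) := by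
        rw [lintegral_add_left (by fun_prop), lintegral_add_left (by fun_prop),
          lintegral_add_left (by fun_prop), lintegral_const_mul _ (by fun_prop),
          lintegral_const_mul _ (by fun_prop), lintegral_const_mul _ (by fun_prop),
          lintegral_const_mul _ (by fun_prop)]
    _ ≤ d * (a * d) + (a * (d * d) + (ψ s * d * (a * a) + ψ s * a * (a * d))) := by gcongr
    _ = _ := by ring

/-- The innermost integral gives a factor `a` and each of the other three gives `2 * a * d`. The
last shift is `s = 0`, where `ψ` vanishes and the weight reduces to `d`. -/
theorem lintegral_chain_four_le (hG : Measurable G) (hψ : Measurable ψ)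
    (h0 : ∫⁻ u, G u ≤ a * a) (h1 : ∫⁻ u, ψ u * G u ≤ a * d) (h2 : ∫⁻ u, ψ u ^ 2 * G u ≤ d * d)
    (hsub : ∀ u s, ψ (u - s) ≤ ψ u + ψ s) (hψ0 : ψ 0 = 0) :
    ∫⁻ t₄, ∫⁻ t₃, ∫⁻ t₂, ∫⁻ t₁, ψ t₄ * G t₄ * (ψ t₃ * G (t₃ + t₄)) *
      (ψ t₂ * G (t₂ + (t₃ + t₄))) * (ψ t₁ * G (t₁ + (t₂ + (t₃ + t₄)))) ≤ 8 * (a * a) ^ 2 * (d * d) ^ 2 := by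
  have e1 : ∀ t₄ t₃ t₂, ∫⁻ t₁, ψ t₄ * G t₄ * (ψ t₃ * G (t₃ + t₄)) *
      (ψ t₂ * G (t₂ + (t₃ + t₄))) * (ψ t₁ * G (t₁ + (t₂ + (t₃ + t₄)))) ≤
      (ψ t₄ * G t₄ * (ψ t₃ * G (t₃ + t₄)) * a) *
        (ψ t₂ * G (t₂ + (t₃ + t₄)) * (d + ψ (t₂ + (t₃ + t₄)) * a)) := by
    intro t₄ t₃ t₂
    rw [lintegral_const_mul _ (by fun_prop)]
    calc _ ≤ ψ t₄ * G t₄ * (ψ t₃ * G (t₃ + t₄)) * (ψ t₂ * G (t₂ + (t₃ + t₄))) *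
          (a * (d + ψ (t₂ + (t₃ + t₄)) * a)) := by
          gcongr
          exact lintegral_chain_first_le hG hψ h0 h1 hsub _
      _ = _ := by ring
  have e2 : ∀ t₄ t₃, ∫⁻ t₂, (ψ t₄ * G t₄ * (ψ t₃ * G (t₃ + t₄)) * a) *
        (ψ t₂ * G (t₂ + (t₃ + t₄)) * (d + ψ (t₂ + (t₃ + t₄)) * a)) ≤
      (ψ t₄ * G t₄ * (2 * a * d) * a) * (ψ t₃ * G (t₃ + t₄) * (d + ψ (t₃ + t₄) * a)) := by
    intro t₄ t₃
    rw [lintegral_const_mul _ (by fun_prop)]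
    calc _ ≤ (ψ t₄ * G t₄ * (ψ t₃ * G (t₃ + t₄)) * a) * (2 * a * d * (d + ψ (t₃ + t₄) * a)) := by
          gcongr
          exact lintegral_chain_step_le hG hψ h0 h1 h2 hsub _
      _ = _ := by ring
  have e3 : ∀ t₄, ∫⁻ t₃,
      (ψ t₄ * G t₄ * (2 * a * d) * a) * (ψ t₃ * G (t₃ + t₄) * (d + ψ (t₃ + t₄) * a)) ≤
      ((2 * a * d) * (2 * a * d) * a) * (ψ t₄ * G (t₄ + 0) * (d + ψ (t₄ + 0) * a)) := by
    intro t₄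
    rw [lintegral_const_mul _ (by fun_prop), add_zero]
    calc _ ≤ (ψ t₄ * G t₄ * (2 * a * d) * a) * (2 * a * d * (d + ψ t₄ * a)) := by
          gcongr
          exact lintegral_chain_step_le hG hψ h0 h1 h2 hsub _
      _ = _ := by ring
  calc _ ≤ ∫⁻ t₄, ((2 * a * d) * (2 * a * d) * a) *
        (ψ t₄ * G (t₄ + 0) * (d + ψ (t₄ + 0) * a)) := by
        refine lintegral_mono fun t₄ => le_trans (lintegral_mono fun t₃ => ?_) (e3 t₄)
        exact le_trans (lintegral_mono fun t₂ => e1 t₄ t₃ t₂) (e2 t₄ t₃)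
    _ ≤ ((2 * a * d) * (2 * a * d) * a) * (2 * a * d * (d + ψ 0 * a)) := by
        rw [lintegral_const_mul _ (by fun_prop)]
        gcongr
        exact lintegral_chain_step_le hG hψ h0 h1 h2 hsub 0
    _ = _ := by rw [hψ0]; ring

end ChainIntegral

/-! ### Integrals of truncated Gaussian sums -/

section GaussianSums

/-- The truncated Gaussian `1_{|u| ≤ R} e^{-c u² l}`. -/
noncomputable def truncGaussian (c R : ℝ) (l : ℕ) (u : ℝ) : ℝ≥0∞ :=
  (Set.Icc (-R) R).indicator (fun u => ENNReal.ofReal (Real.exp (-c * u ^ 2 * l))) u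

/-- The cut-off distance `min(1, δ|u|)`. -/
noncomputable def cutoffDist (δ : ℝ) (u : ℝ) : ℝ≥0∞ := ENNReal.ofReal (min 1 (|u| * δ))

theorem measurable_truncGaussian (c R : ℝ) (l : ℕ) : Measurable (truncGaussian c R l) :=
  Measurable.indicator (by fun_prop) measurableSet_Icc

theorem measurable_cutoffDist (δ : ℝ) : Measurable (cutoffDist δ) := by
  unfold cutoffDist; fun_prop

theorem cutoffDist_sub_le {δ : ℝ} (hδ : 0 ≤ δ) (u s : ℝ) :
    cutoffDist δ (u - s) ≤ cutoffDist δ u + cutoffDist δ s := by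
  unfold cutoffDist
  rw [← ENNReal.ofReal_add (by positivity) (by positivity)]
  refine ENNReal.ofReal_le_ofReal ?_
  have h1 : |u - s| * δ ≤ |u| * δ + |s| * δ := by
    rw [← add_mul]; exact mul_le_mul_of_nonneg_right (abs_sub _ _) hδ
  have h2 : 0 ≤ |u| * δ := by positivity
  have h3 : 0 ≤ |s| * δ := by positivity
  rcases le_total 1 (|u| * δ) with h | h <;> rcases le_total 1 (|s| * δ) with h' | h' <;>
    simp only [h, h', min_eq_left, min_eq_right] <;>
    first
    | exact (min_le_right _ _).trans (by linarith)
    | exact (min_le_left _ _).trans (by linarith)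

theorem sum_inv_sqrt_le (n : ℕ) : ∑ l ∈ Finset.range n, (√(l + 1 : ℕ))⁻¹ ≤ 2 * √n := by
  induction n with
  | zero => simp
  | succ n ih =>
    rw [Finset.sum_range_succ]
    have h1 : 0 < √((n + 1 : ℕ) : ℝ) := Real.sqrt_pos.2 (by positivity)
    have h2 : 0 ≤ √(n : ℝ) := Real.sqrt_nonneg _
    have h3 : √(n : ℝ) ≤ √((n + 1 : ℕ) : ℝ) := Real.sqrt_le_sqrt (by push_cast; linarith)
    have h4 : √((n + 1 : ℕ) : ℝ) ^ 2 = n + 1 := by rw [Real.sq_sqrt (by positivity)]; push_cast; rfl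
    have h5 : √(n : ℝ) ^ 2 = n := Real.sq_sqrt (by positivity)
    have h6 : (√((n + 1 : ℕ) : ℝ))⁻¹ ≤ 2 * √((n + 1 : ℕ) : ℝ) - 2 * √(n : ℝ) := by
      rw [inv_le_iff_one_le_mul₀ h1]
      nlinarith
    linarith

/-- The term `l = 0` does not decay and contributes the length `2R` of the interval. The others
contribute `√(π/(c l))`, which sum to order `√n`; `1 ≤ √n` absorbs the first term. -/
theorem lintegral_sum_truncGaussian_le {c R : ℝ} (hc : 0 < c) (hR : 0 ≤ R) {n : ℕ} (hn : 1 ≤ n) :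
    ∫⁻ u, ∑ l ∈ Finset.range (n + 1), truncGaussian c R l u
      ≤ ENNReal.ofReal ((2 * R + 2 * √(Real.pi / c)) * √n) := by
  rw [lintegral_finsetSum _ fun l _ => measurable_truncGaussian c R l, Finset.sum_range_succ']
  have h0 : ∫⁻ u, truncGaussian c R 0 u = ENNReal.ofReal (2 * R) := by
    unfold truncGaussian
    rw [lintegral_indicator measurableSet_Icc]
    simp [two_mul, ENNReal.ofReal_add hR hR]
  have h1 : ∀ l : ℕ, ∫⁻ u, truncGaussian c R (l + 1) u
      ≤ ENNReal.ofReal (√(Real.pi / c) * (√(l + 1 : ℕ))⁻¹) := by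
    intro l
    have hb : 0 < c * (l + 1 : ℕ) := by positivity
    calc ∫⁻ u, truncGaussian c R (l + 1) u
        ≤ ∫⁻ u, ENNReal.ofReal (Real.exp (-(c * (l + 1 : ℕ)) * u ^ 2)) := by
          refine lintegral_mono fun u => ?_
          refine (Set.indicator_le_self _ _ u).trans (le_of_eq ?_)
          congr 2; ring
      _ = ENNReal.ofReal (√(Real.pi / (c * (l + 1 : ℕ)))) := by
          rw [← ofReal_integral_eq_lintegral_ofReal (integrable_exp_neg_mul_sq hb)
            (ae_of_all _ fun u => (Real.exp_pos _).le), integral_gaussian]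
      _ = _ := by rw [← div_div, Real.sqrt_div (by positivity), div_eq_mul_inv]
  rw [h0]
  refine (add_le_add_left (Finset.sum_le_sum fun l _ => h1 l) _).trans ?_
  rw [← ENNReal.ofReal_sum_of_nonneg (fun l _ => by positivity), ← Finset.mul_sum,
    ← ENNReal.ofReal_add (by positivity) (by positivity)]
  refine ENNReal.ofReal_le_ofReal ?_
  have h2 := mul_le_mul_of_nonneg_left (sum_inv_sqrt_le n) (Real.sqrt_nonneg (Real.pi / c))
  have h3 : 1 ≤ √(n : ℝ) := Real.one_le_sqrt.2 (by exact_mod_cast hn)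
  nlinarith

/-- The geometric series is compared using `exp(-y) ≤ 1/(1 + y)`. -/
theorem sum_exp_neg_mul_le {y : ℝ} (hy : 0 < y) (n : ℕ) :
    ∑ l ∈ Finset.range n, Real.exp (-y * l) ≤ 1 + y⁻¹ := by
  have hlt : Real.exp (-y) < 1 := Real.exp_lt_one_iff.2 (by linarith)
  have h1 : ∑ l ∈ Finset.range n, Real.exp (-y) ^ l ≤ (1 - Real.exp (-y))⁻¹ := by
    rw [← tsum_geometric_of_lt_one (Real.exp_pos _).le hlt]
    exact (summable_geometric_of_lt_one (Real.exp_pos _).le hlt).sum_le_tsum _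
      fun i _ => by positivity
  have h2 : (1 - Real.exp (-y))⁻¹ ≤ 1 + y⁻¹ := by
    rw [inv_le_comm₀ (by linarith) (by positivity)]
    have h3 : Real.exp (-y) ≤ (1 + y)⁻¹ := by
      rw [Real.exp_neg]
      exact inv_anti₀ (by positivity) (by linarith [Real.add_one_le_exp y])
    have h4 : (1 + y⁻¹)⁻¹ = 1 - (1 + y)⁻¹ := by field_simp; ring
    linarith
  refine le_trans (le_of_eq (Finset.sum_congr rfl fun l _ => ?_)) (h1.trans h2)
  rw [← Real.exp_nat_mul]; ring_nf

/-- On `|u| ≤ R` the Gaussian sum is at most `(R² + 1/c)/u²`, whatever `n` is. Multiplied by the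
squared cut-off it is dominated by a Cauchy density of scale `1/δ`, whose integral is explicit. -/
theorem lintegral_cutoffDist_sq_mul_le {c R δ : ℝ} (hc : 0 < c) (hδ : 0 < δ) (n : ℕ) :
    ∫⁻ u, cutoffDist δ u ^ 2 * ∑ l ∈ Finset.range n, truncGaussian c R l u
      ≤ ENNReal.ofReal (2 * (R ^ 2 + c⁻¹) * Real.pi * δ) := by
  have key : ∀ u, cutoffDist δ u ^ 2 * ∑ l ∈ Finset.range n, truncGaussian c R l u
      ≤ ENNReal.ofReal (2 * (R ^ 2 + c⁻¹) * δ ^ 2 * (1 + (δ * u) ^ 2)⁻¹) := by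
    intro u
    by_cases hu : u ∈ Set.Icc (-R) R
    swap
    · simp [truncGaussian, hu]
    rcases eq_or_ne u 0 with rfl | hu0
    · simp [cutoffDist]
    simp only [truncGaussian, Set.indicator_of_mem hu, cutoffDist]
    rw [← ENNReal.ofReal_sum_of_nonneg fun l _ => (Real.exp_pos _).le,
      ← ENNReal.ofReal_pow (by positivity), ← ENNReal.ofReal_mul (by positivity)]
    refine ENNReal.ofReal_le_ofReal ?_
    have hu2 : 0 < u ^ 2 := by positivity
    have h1 : ∑ l ∈ Finset.range n, Real.exp (-c * u ^ 2 * l) ≤ (R ^ 2 + c⁻¹) / u ^ 2 := by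
      have := sum_exp_neg_mul_le (mul_pos hc hu2) n
      simp only [neg_mul] at this ⊢
      refine this.trans ?_
      rw [add_div, mul_inv, div_eq_mul_inv, div_eq_mul_inv]
      gcongr
      rw [← div_eq_mul_inv, one_le_div hu2, sq_le_sq]
      have hR : 0 ≤ R := by linarith [hu.1, hu.2]
      rw [abs_of_nonneg hR]
      exact abs_le.2 hu
    -- The elementary bound `min(1, z)² ≤ 2z²/(1 + z²)`, with `z = δ|u|`.
    have h2 : min 1 (|u| * δ) ^ 2 ≤ 2 * (δ ^ 2 * u ^ 2) * (1 + (δ * u) ^ 2)⁻¹ := by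
      rw [← div_eq_mul_inv, le_div_iff₀ (by positivity)]
      have h3 : min 1 (|u| * δ) ^ 2 ≤ 1 := pow_le_one₀ (by positivity) (min_le_left _ _)
      have h4 : min 1 (|u| * δ) ^ 2 ≤ δ ^ 2 * u ^ 2 := by
        calc min 1 (|u| * δ) ^ 2 ≤ (|u| * δ) ^ 2 := by gcongr; exact min_le_right _ _
          _ = _ := by rw [mul_pow, sq_abs, mul_comm]
      have h5 : 0 ≤ δ ^ 2 * u ^ 2 := by positivity
      nlinarith
    calc min 1 (|u| * δ) ^ 2 * ∑ l ∈ Finset.range n, Real.exp (-c * u ^ 2 * l)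
        ≤ 2 * (δ ^ 2 * u ^ 2) * (1 + (δ * u) ^ 2)⁻¹ * ((R ^ 2 + c⁻¹) / u ^ 2) := by gcongr
      _ = _ := by field_simp
  refine (lintegral_mono key).trans ?_
  have hint : Integrable fun u : ℝ => (1 + (δ * u) ^ 2)⁻¹ :=
    integrable_inv_one_add_sq.comp_mul_left' hδ.ne'
  rw [← ofReal_integral_eq_lintegral_ofReal (hint.const_mul _)
    (ae_of_all _ fun u => by positivity), integral_const_mul,
    Measure.integral_comp_mul_left (fun u : ℝ => (1 + u ^ 2)⁻¹), integral_univ_inv_one_add_sq,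
    abs_of_pos (by positivity), smul_eq_mul]
  refine ENNReal.ofReal_le_ofReal (le_of_eq ?_)
  field_simp

/-- The mixed moment, by the Cauchy-Schwarz inequality. -/
theorem lintegral_mul_le_of_sq {α : Type*} [MeasurableSpace α] {μ : Measure α} {G ψ : α → ℝ≥0∞}
    (hG : Measurable G) (hψ : Measurable ψ) {a d : ℝ≥0∞}
    (h0 : ∫⁻ u, G u ∂μ ≤ a * a) (h2 : ∫⁻ u, ψ u ^ 2 * G u ∂μ ≤ d * d) :
    ∫⁻ u, ψ u * G u ∂μ ≤ a * d := by
  have hsq : ∀ x : ℝ≥0∞, (x * x) ^ (1 / 2 : ℝ) = x := fun x => by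
    rw [← sq, ← ENNReal.rpow_natCast, ← ENNReal.rpow_mul]; norm_num
  have h := ENNReal.lintegral_mul_le_Lp_mul_Lq μ (Real.HolderConjugate.two_two)
    (f := fun u => G u ^ (1 / 2 : ℝ)) (g := fun u => ψ u * G u ^ (1 / 2 : ℝ))
    (by fun_prop) (by fun_prop)
  have hG2 : ∀ u, (G u ^ (1 / 2 : ℝ)) ^ (2 : ℝ) = G u := fun u => by
    rw [← ENNReal.rpow_mul]; norm_num
  have e1 : ∀ u, (ψ u * G u ^ (1 / 2 : ℝ)) ^ (2 : ℝ) = ψ u ^ 2 * G u := fun u => by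
    rw [ENNReal.mul_rpow_of_nonneg _ _ (by norm_num), hG2]; norm_num
  simp only [Pi.mul_apply, hG2, e1] at h
  calc ∫⁻ u, ψ u * G u ∂μ = ∫⁻ u, G u ^ (1 / 2 : ℝ) * (ψ u * G u ^ (1 / 2 : ℝ)) ∂μ := by
        refine lintegral_congr fun u => ?_
        have : G u ^ (1 / 2 : ℝ) * G u ^ (1 / 2 : ℝ) = G u := by
          rw [← ENNReal.rpow_add_of_nonneg _ _ (by norm_num) (by norm_num)]; norm_num
        rw [mul_left_comm, this]
    _ ≤ (a * a) ^ (1 / 2 : ℝ) * (d * d) ^ (1 / 2 : ℝ) := by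
        refine h.trans ?_
        gcongr
    _ = a * d := by rw [hsq, hsq]

end GaussianSums

/-! ### Sums over sorted quadruples -/

section Sorting

/-- The partial sums of a quadruple of gaps. -/
def gapSum (l : Fin 4 → ℕ) : Fin 4 → ℕ := ![l 0, l 0 + l 1, l 0 + l 1 + l 2, l 0 + l 1 + l 2 + l 3]

/-- The gaps of a quadruple. -/
def gaps (k : Fin 4 → ℕ) : Fin 4 → ℕ := ![k 0, k 1 - k 0, k 2 - k 1, k 3 - k 2]

theorem gapSum_gaps {k : Fin 4 → ℕ} (hk : Monotone k) : gapSum (gaps k) = k := by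
  have h1 : k 0 ≤ k 1 := hk (by decide)
  have h2 : k 1 ≤ k 2 := hk (by decide)
  have h3 : k 2 ≤ k 3 := hk (by decide)
  ext i
  fin_cases i <;> simp [gapSum, gaps] <;> omega

/-- The sum of a symmetric function over quadruples is at most `4!` times its sum over sorted
quadruples, the latter parametrized by their gaps. -/
theorem sum_quadruples_le (F : (Fin 4 → ℕ) → ℝ≥0∞)
    (hF : ∀ k (τ : Equiv.Perm (Fin 4)), F (k ∘ τ) = F k) (n : ℕ) :
    ∑ k ∈ Fintype.piFinset (fun _ : Fin 4 => Finset.Icc 1 n), F k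
      ≤ 24 * ∑ l ∈ Fintype.piFinset (fun _ : Fin 4 => Finset.range (n + 1)), F (gapSum l) := by
  classical
  set Φ : (Fin 4 → ℕ) → Equiv.Perm (Fin 4) × (Fin 4 → ℕ) :=
    fun k => (Tuple.sort k, gaps (k ∘ Tuple.sort k)) with hΦ
  have hback : ∀ k, gapSum (Φ k).2 = k ∘ (Φ k).1 := fun k => gapSum_gaps (Tuple.monotone_sort k)
  -- The gaps give the sorted quadruple and the permutation undoes the sorting, so no quadruple is
  -- lost. The image may be enlarged to the full product since all terms are nonnegative.
  have hinj : Function.Injective Φ := by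
    intro k k' h
    have h1 := hback k
    rw [h, hback k'] at h1
    ext i
    have := congrFun h1 ((Φ k').1.symm i)
    simpa using this.symm
  calc ∑ k ∈ Fintype.piFinset (fun _ : Fin 4 => Finset.Icc 1 n), F k
      = ∑ p ∈ (Fintype.piFinset (fun _ : Fin 4 => Finset.Icc 1 n)).image Φ, F (gapSum p.2) := by
        rw [Finset.sum_image hinj.injOn]
        refine Finset.sum_congr rfl fun k _ => ?_
        rw [hback, hF]
    _ ≤ ∑ p ∈ Finset.univ ×ˢ Fintype.piFinset (fun _ : Fin 4 => Finset.range (n + 1)),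
          F (gapSum p.2) := by
        refine Finset.sum_le_sum_of_subset fun p hp => ?_
        obtain ⟨k, hk, rfl⟩ := Finset.mem_image.1 hp
        rw [Finset.mem_product]
        refine ⟨Finset.mem_univ _, Fintype.mem_piFinset.2 fun i => Finset.mem_range.2 ?_⟩
        have hk' : ∀ j, k j < n + 1 := fun j =>
          Nat.lt_succ_of_le (Finset.mem_Icc.1 (Fintype.mem_piFinset.1 hk j)).2
        have h0 := hk' (Tuple.sort k 0)
        have h1 := hk' (Tuple.sort k 1)
        have h2 := hk' (Tuple.sort k 2)
        have h3 := hk' (Tuple.sort k 3)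
        fin_cases i <;> simp [hΦ, gaps] <;> omega
    _ = _ := by
        rw [Finset.sum_product]
        simp only [Finset.sum_const, Finset.card_univ, Fintype.card_perm, Fintype.card_fin,
          nsmul_eq_mul]
        congr 1

end Sorting

/-! ### Fourier expansion of products -/

section FourierExpansion

variable {X : Type*} [MeasurableSpace X] {m : Measure X} [IsProbabilityMeasure m]

/-- The phase `e^{2π i t s}`. -/
noncomputable def phase (t s : ℝ) : ℂ := Complex.exp (Complex.I * (2 * Real.pi * t : ℝ) * s)

theorem norm_phase (t s : ℝ) : ‖phase t s‖ = 1 := norm_exp_I_mul_mul _ _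

theorem phase_add_right (t s s' : ℝ) : phase t (s + s') = phase t s * phase t s' := by
  unfold phase; rw [← Complex.exp_add]; push_cast; ring_nf

theorem phase_add_left (t t' s : ℝ) : phase (t + t') s = phase t s * phase t' s := by
  unfold phase; rw [← Complex.exp_add]; push_cast; ring_nf

theorem measurable_phase : Measurable fun p : ℝ × ℝ => phase p.1 p.2 := by
  unfold phase; fun_prop

/-- Pulling a Fourier integral out of an expectation. -/
theorem enorm_integral_mul_fourier_le {H : X → ℂ} (hH : Integrable H m) {g : ℝ → ℂ}
    (hg : Integrable g) {S : X → ℝ} (hS : Measurable S) :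
    ‖∫ x, H x * (∫ t, g t * phase t (S x)) ∂m‖ₑ
      ≤ ∫⁻ t, ‖∫ x, H x * (g t * phase t (S x)) ∂m‖ₑ := by
  have hint : Integrable (fun p : X × ℝ => H p.1 * (g p.2 * phase p.2 (S p.1))) (m.prod volume) := by
    have h1 : Integrable (fun p : X × ℝ => H p.1 * g p.2) (m.prod volume) := hH.mul_prod hg
    have h2 := h1.mul_bdd (g := fun p : X × ℝ => phase p.2 (S p.1)) (c := 1)
      (measurable_phase.comp (measurable_snd.prodMk (hS.comp measurable_fst))).aestronglyMeasurable
      (ae_of_all _ fun p => (norm_phase _ _).le)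
    refine h2.congr (ae_of_all _ fun p => ?_)
    simp only [mul_assoc]
  calc _ = ‖∫ x, (∫ t, H x * (g t * phase t (S x))) ∂m‖ₑ := by simp only [integral_const_mul]
    _ = ‖∫ t, (∫ x, H x * (g t * phase t (S x)) ∂m)‖ₑ := by rw [integral_integral_swap hint]
    _ ≤ _ := enorm_integral_le_lintegral_enorm _

theorem integrable_mul_bounded {Y : Type*} [MeasurableSpace Y] {m : Measure Y} {H a : Y → ℂ} (hH : Integrable H m) (ha : Measurable a) {K : ℝ}
    (hK : ∀ x, ‖a x‖ ≤ K) : Integrable (fun x => H x * a x) m :=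
  hH.mul_bdd ha.aestronglyMeasurable (ae_of_all _ hK)

/-- The factors are expanded one at a time, the latest time first, and the modulus is taken after
each exchange of integrals. The factors not yet expanded stay bounded, which gives the integrability
needed for Fubini. -/
theorem enorm_integral_prod_four_fourier_le {g : ℝ → ℂ} (hg : Integrable g)
    {S : Fin 4 → X → ℝ} (hS : ∀ i, Measurable (S i)) {a : ℝ → ℂ} (ha : Measurable a) {K : ℝ}
    (hK : ∀ s, ‖a s‖ ≤ K) (hga : ∀ s, a s = ∫ t, g t * phase t s) :
    ‖∫ x, ∏ i, a (S i x) ∂m‖ₑ ≤ ∫⁻ t₄, ∫⁻ t₃, ∫⁻ t₂, ∫⁻ t₁,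
      ‖∫ x, g t₄ * phase t₄ (S 3 x) * (g t₃ * phase t₃ (S 2 x)) * (g t₂ * phase t₂ (S 1 x)) *
        (g t₁ * phase t₁ (S 0 x)) ∂m‖ₑ := by
  have hma : ∀ i, Measurable fun x => a (S i x) := fun i => ha.comp (hS i)
  have hint : ∀ {H : X → ℂ}, Integrable H m → ∀ i, Integrable (fun x => H x * a (S i x)) m :=
    fun hH i => integrable_mul_bounded hH (hma i) fun x => hK _
  have hph : ∀ {H : X → ℂ}, Integrable H m → ∀ (t : ℝ) i,
      Integrable (fun x => H x * (g t * phase t (S i x))) m := fun hH t i =>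
    integrable_mul_bounded hH (K := ‖g t‖)
      (measurable_const.mul (measurable_phase.comp (measurable_const.prodMk (hS i))))
      fun x => by rw [norm_mul, norm_phase, mul_one]
  have h1 : Integrable (fun _ : X => (1 : ℂ)) m := integrable_const _
  calc ‖∫ x, ∏ i, a (S i x) ∂m‖ₑ
      = ‖∫ x, 1 * a (S 0 x) * a (S 1 x) * a (S 2 x) * (∫ t, g t * phase t (S 3 x)) ∂m‖ₑ := by
        congr 1
        refine integral_congr_ae (ae_of_all _ fun x => ?_)
        simp only [Fin.prod_univ_four, ← hga, one_mul]
    _ ≤ ∫⁻ t₄, ‖∫ x, 1 * a (S 0 x) * a (S 1 x) * a (S 2 x) * (g t₄ * phase t₄ (S 3 x)) ∂m‖ₑ :=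
        enorm_integral_mul_fourier_le (hint (hint (hint h1 0) 1) 2) hg (hS 3)
    _ ≤ _ := by
        refine lintegral_mono fun t₄ => ?_
        calc _ = ‖∫ x, 1 * (g t₄ * phase t₄ (S 3 x)) * a (S 0 x) * a (S 1 x) *
                (∫ t, g t * phase t (S 2 x)) ∂m‖ₑ := by
              congr 1
              refine integral_congr_ae (ae_of_all _ fun x => ?_)
              simp only [← hga]; ring
          _ ≤ ∫⁻ t₃, ‖∫ x, 1 * (g t₄ * phase t₄ (S 3 x)) * a (S 0 x) * a (S 1 x) *
                (g t₃ * phase t₃ (S 2 x)) ∂m‖ₑ :=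
              enorm_integral_mul_fourier_le (hint (hint (hph h1 t₄ 3) 0) 1) hg (hS 2)
          _ ≤ _ := by
              refine lintegral_mono fun t₃ => ?_
              calc _ = ‖∫ x, 1 * (g t₄ * phase t₄ (S 3 x)) * (g t₃ * phase t₃ (S 2 x)) *
                      a (S 0 x) * (∫ t, g t * phase t (S 1 x)) ∂m‖ₑ := by
                    congr 1
                    refine integral_congr_ae (ae_of_all _ fun x => ?_)
                    simp only [← hga]; ring
                _ ≤ ∫⁻ t₂, ‖∫ x, 1 * (g t₄ * phase t₄ (S 3 x)) * (g t₃ * phase t₃ (S 2 x)) *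
                      a (S 0 x) * (g t₂ * phase t₂ (S 1 x)) ∂m‖ₑ :=
                    enorm_integral_mul_fourier_le (hint (hph (hph h1 t₄ 3) t₃ 2) 0) hg (hS 1)
                _ ≤ _ := by
                    refine lintegral_mono fun t₂ => ?_
                    calc _ = ‖∫ x, 1 * (g t₄ * phase t₄ (S 3 x)) * (g t₃ * phase t₃ (S 2 x)) *
                            (g t₂ * phase t₂ (S 1 x)) * (∫ t, g t * phase t (S 0 x)) ∂m‖ₑ := by
                          congr 1
                          refine integral_congr_ae (ae_of_all _ fun x => ?_)
                          simp only [← hga]; ring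
                      _ ≤ ∫⁻ t₁, ‖∫ x, 1 * (g t₄ * phase t₄ (S 3 x)) * (g t₃ * phase t₃ (S 2 x)) *
                            (g t₂ * phase t₂ (S 1 x)) * (g t₁ * phase t₁ (S 0 x)) ∂m‖ₑ :=
                          enorm_integral_mul_fourier_le
                            (hph (hph (hph h1 t₄ 3) t₃ 2) t₂ 1) hg (hS 0)
                      _ = _ := by simp only [one_mul]

end FourierExpansion

/-! ### Joint characteristic functions of the ergodic sums -/

section JointCharFun

variable {X : Type*} [MeasurableSpace X] {m : Measure X} [IsProbabilityMeasure m]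
  {T : X → X} {φ : X → ℝ} {B : Type*} [NormedAddCommGroup B] [NormedSpace ℂ B]

/-- The summands between two consecutive times are counted by every later `S`, so their block
carries the sum of all later frequencies. Duality then removes one block at a time. -/
theorem integral_phase_four_eq (hT : MeasurePreserving T m m) (hφ : Measurable φ)
    {ι : B →L[ℂ] Lp ℂ ∞ m} {P : ℝ → B →L[ℂ] B} (hP : RestrictsTo T φ ι P) {e : B}
    (he : ι e =ᵐ[m] fun _ => 1) (t₁ t₂ t₃ t₄ : ℝ) (l : Fin 4 → ℕ) :
    ∫ x, phase t₄ (ergodicSum T φ (gapSum l 3) x) * phase t₃ (ergodicSum T φ (gapSum l 2) x) *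
        phase t₂ (ergodicSum T φ (gapSum l 1) x) * phase t₁ (ergodicSum T φ (gapSum l 0) x) ∂m
      = massFunctional ι ((P (2 * Real.pi * t₄) ^ l 3) ((P (2 * Real.pi * (t₃ + t₄)) ^ l 2)
        ((P (2 * Real.pi * (t₂ + (t₃ + t₄))) ^ l 1)
          ((P (2 * Real.pi * (t₁ + (t₂ + (t₃ + t₄)))) ^ l 0) e)))) := by
  set E : ℝ → ℕ → X → ℂ := fun t n x => phase t (ergodicSum T φ n x) with hE
  have hEm : ∀ t n, Measurable (E t n) := fun t n =>
    measurable_phase.comp (measurable_const.prodMk (measurable_ergodicSum hT.measurable hφ n))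
  have hEn : ∀ t n x, ‖E t n x‖ ≤ 1 := fun t n x => (norm_phase _ _).le
  have hstep : ∀ (t : ℝ) (n : ℕ) (b : B) (v : X → ℂ), Measurable v → (∀ x, ‖v x‖ ≤ 1) →
      ∫ x, ι ((P (2 * Real.pi * t) ^ n) b) x * v x ∂m
        = ∫ x, ι b x * (E t n x * v (T^[n] x)) ∂m := fun t n b v hv hv1 =>
    integral_pow_mul hT hφ hP _ n b hv hv1
  have hcm : ∀ (t : ℝ) (n : ℕ) (v : X → ℂ), Measurable v →
      Measurable fun x => E t n x * v (T^[n] x) := fun t n v hv =>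
    (hEm t n).mul (hv.comp (hT.measurable.iterate n))
  have hcn : ∀ (t : ℝ) (n : ℕ) (v : X → ℂ), (∀ x, ‖v x‖ ≤ 1) →
      ∀ x, ‖E t n x * v (T^[n] x)‖ ≤ 1 := fun t n v hv x => by
    rw [norm_mul]; exact mul_le_one₀ (hEn t n x) (norm_nonneg _) (hv _)
  have h4 := massFunctional_pow hT hφ hP (2 * Real.pi * t₄) (l 3)
    ((P (2 * Real.pi * (t₃ + t₄)) ^ l 2) ((P (2 * Real.pi * (t₂ + (t₃ + t₄))) ^ l 1)
          ((P (2 * Real.pi * (t₁ + (t₂ + (t₃ + t₄)))) ^ l 0) e)))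
  rw [h4]
  have m4 := hEm t₄ (l 3)
  have n4 := hEn t₄ (l 3)
  have m3 := hcm (t₃ + t₄) (l 2) _ m4
  have n3 := hcn (t₃ + t₄) (l 2) _ n4
  have m2 := hcm (t₂ + (t₃ + t₄)) (l 1) _ m3
  have n2 := hcn (t₂ + (t₃ + t₄)) (l 1) _ n3
  refine Eq.trans ?_ (hstep _ _ _ _ m4 n4).symm
  rw [hstep _ _ _ _ m3 n3, hstep _ _ _ _ m2 n2]
  refine integral_congr_ae ?_
  filter_upwards [he] with x hx
  rw [hx, one_mul]
  simp only [hE, gapSum, Matrix.cons_val, ergodicSum_add, phase_add_right, phase_add_left,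
    ← Function.iterate_add_apply]
  rw [add_comm (l 1) (l 0), add_comm (l 2) (l 0 + l 1)]
  ring

end JointCharFun

/-! ### The fourth moment bound -/

section FourthMoment

/-- The trivial bound `2` and the Lipschitz bound share the constant `2π`, which yields the cut-off
form. -/
theorem norm_phase_sub_le (t s s' : ℝ) :
    ‖phase t s - phase t s'‖ ≤ 2 * Real.pi * min 1 (|t| * |s - s'|) := by
  have h1 : ‖phase t s - phase t s'‖ ≤ 2 := by
    refine (norm_sub_le _ _).trans ?_
    rw [norm_phase, norm_phase]; norm_num
  have h2 : ‖phase t s - phase t s'‖ ≤ 2 * Real.pi * (|t| * |s - s'|) := by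
    have e : phase t s - phase t s' = phase t s' * (phase t (s - s') - 1) := by
      rw [mul_sub, ← phase_add_right, mul_one]; congr 2; ring
    rw [e, norm_mul, norm_phase, one_mul]
    have h3 := Real.norm_exp_I_mul_ofReal_sub_one_le (x := 2 * Real.pi * t * (s - s'))
    have h4 : phase t (s - s') = Complex.exp (Complex.I * (2 * Real.pi * t * (s - s') : ℝ)) := by
      unfold phase; congr 1; push_cast; ring
    rw [h4]
    refine h3.trans (le_of_eq ?_)
    rw [Real.norm_eq_abs, abs_mul, abs_mul, abs_of_pos Real.two_pi_pos]; ring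
  rw [mul_min_of_nonneg _ _ Real.two_pi_pos.le]
  refine le_min (h1.trans ?_) h2
  linarith [Real.pi_gt_three]

/-- A continuous integrable function with compactly supported Fourier transform is the Fourier
integral of a bounded integrable function with bounded support. -/
theorem exists_fourier_representation {f : ℝ → ℝ} (hf : Continuous f) (hfint : Integrable f)
    (hfhat : HasCompactSupport (𝓕 fun s : ℝ => (f s : ℂ))) :
    ∃ (F : ℝ → ℂ) (A r : ℝ), Integrable F ∧ 0 ≤ A ∧ 0 ≤ r ∧ (∀ t, ‖F t‖ ≤ A) ∧
      (∀ t, r < |t| → F t = 0) ∧ ∀ s, (f s : ℂ) = ∫ t, F t * phase t s := by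
  set F := 𝓕 fun s : ℝ => (f s : ℂ) with hF
  have hFc : Continuous F :=
    VectorFourier.fourierIntegral_continuous Real.continuous_fourierChar
      (by exact continuous_inner) hfint.ofReal
  have hFi : Integrable F := hFc.integrable_of_hasCompactSupport hfhat
  obtain ⟨A, hA⟩ := hFc.bounded_above_of_compact_support hfhat
  obtain ⟨r, hr⟩ := hfhat.isCompact.isBounded.exists_norm_le
  refine ⟨F, A, max r 0, hFi, (norm_nonneg _).trans (hA 0), le_max_right _ _, hA,
    fun t ht => ?_, fun s => ?_⟩
  · by_contra h
    have := hr t (subset_tsupport _ h)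
    rw [Real.norm_eq_abs] at this
    exact absurd (ht.trans_le this) (not_lt.2 (le_max_left _ _))
  · have h := (Complex.continuous_ofReal.comp hf).fourierInv_fourier_eq hfint.ofReal hFi
    have h1 := congrFun h s
    rw [Function.comp_apply] at h1
    rw [← h1, Real.fourierInv_eq']
    refine integral_congr_ae (ae_of_all _ fun t => ?_)
    simp only [smul_eq_mul, phase]
    rw [mul_comm]
    congr 2
    simp
    ring

variable {X : Type*} [MeasurableSpace X] {m : Measure X} [IsProbabilityMeasure m]
  {T : X → X} {φ : X → ℝ} {B : Type*} [NormedAddCommGroup B] [NormedSpace ℂ B]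

theorem enorm_integral_phase_four_le (hT : MeasurePreserving T m m) (hφ : Measurable φ)
    {ι : B →L[ℂ] Lp ℂ ∞ m} {P : ℝ → B →L[ℂ] B} (hP : RestrictsTo T φ ι P) {e : B}
    (he : ι e =ᵐ[m] fun _ => 1) {K c R : ℝ} (hK : 0 ≤ K)
    (hop : ∀ u ∈ Set.Icc (-R) R, ∀ k : ℕ,
      ‖P (2 * Real.pi * u) ^ k‖ ≤ K * Real.exp (-c * u ^ 2 * k))
    {t₁ t₂ t₃ t₄ : ℝ} (h₄ : t₄ ∈ Set.Icc (-R) R) (h₃ : t₃ + t₄ ∈ Set.Icc (-R) R)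
    (h₂ : t₂ + (t₃ + t₄) ∈ Set.Icc (-R) R) (h₁ : t₁ + (t₂ + (t₃ + t₄)) ∈ Set.Icc (-R) R)
    (l : Fin 4 → ℕ) :
    ‖∫ x, phase t₄ (ergodicSum T φ (gapSum l 3) x) * phase t₃ (ergodicSum T φ (gapSum l 2) x) *
        phase t₂ (ergodicSum T φ (gapSum l 1) x) * phase t₁ (ergodicSum T φ (gapSum l 0) x) ∂m‖ₑ
      ≤ ENNReal.ofReal (‖ι‖ * K ^ 4 * ‖e‖) *
        (truncGaussian c R (l 3) t₄ * truncGaussian c R (l 2) (t₃ + t₄) *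
          truncGaussian c R (l 1) (t₂ + (t₃ + t₄)) *
          truncGaussian c R (l 0) (t₁ + (t₂ + (t₃ + t₄)))) := by
  rw [integral_phase_four_eq hT hφ hP he]
  simp only [truncGaussian, Set.indicator_of_mem h₁, Set.indicator_of_mem h₂,
    Set.indicator_of_mem h₃, Set.indicator_of_mem h₄]
  rw [← ENNReal.ofReal_mul (by positivity), ← ENNReal.ofReal_mul (by positivity),
    ← ENNReal.ofReal_mul (by positivity), ← ENNReal.ofReal_mul (by positivity),
    ← ofReal_norm]
  refine ENNReal.ofReal_le_ofReal ?_
  have hM : ∀ b, ‖massFunctional ι b‖ ≤ ‖ι‖ * ‖b‖ := fun b => by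
    simpa using norm_massFunctional_pow_le hT hφ hP 0 0 b
  have q : ∀ {u}, u ∈ Set.Icc (-R) R → ∀ (k : ℕ) (b : B),
      ‖(P (2 * Real.pi * u) ^ k) b‖ ≤ K * Real.exp (-c * u ^ 2 * k) * ‖b‖ := fun hu k b =>
    ContinuousLinearMap.le_of_opNorm_le _ (hop _ hu k) b
  set b₁ := (P (2 * Real.pi * (t₁ + (t₂ + (t₃ + t₄)))) ^ l 0) e with hb₁
  set b₂ := (P (2 * Real.pi * (t₂ + (t₃ + t₄))) ^ l 1) b₁ with hb₂
  set b₃ := (P (2 * Real.pi * (t₃ + t₄)) ^ l 2) b₂ with hb₃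
  set x₁ := Real.exp (-c * (t₁ + (t₂ + (t₃ + t₄))) ^ 2 * l 0)
  set x₂ := Real.exp (-c * (t₂ + (t₃ + t₄)) ^ 2 * l 1)
  set x₃ := Real.exp (-c * (t₃ + t₄) ^ 2 * l 2)
  set x₄ := Real.exp (-c * t₄ ^ 2 * l 3)
  have e1 : ‖b₁‖ ≤ K * x₁ * ‖e‖ := q h₁ (l 0) e
  have e2 : ‖b₂‖ ≤ K * x₂ * ‖b₁‖ := q h₂ (l 1) b₁
  have e3 : ‖b₃‖ ≤ K * x₃ * ‖b₂‖ := q h₃ (l 2) b₂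
  have e4 := q h₄ (l 3) b₃
  calc _ ≤ ‖ι‖ * (K * x₄ * ‖b₃‖) := (hM _).trans (by gcongr)
    _ ≤ ‖ι‖ * (K * x₄ * (K * x₃ * (K * x₂ * (K * x₁ * ‖e‖)))) := by
        have hx₁ : 0 ≤ x₁ := (Real.exp_pos _).le
        have hx₂ : 0 ≤ x₂ := (Real.exp_pos _).le
        have hx₃ : 0 ≤ x₃ := (Real.exp_pos _).le
        have hx₄ : 0 ≤ x₄ := (Real.exp_pos _).le
        gcongr
        refine e3.trans ?_
        gcongr
        refine e2.trans ?_
        gcongr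
    _ = _ := by ring

/-- The gaps range over a box, so the sum of products factors into a product of four sums `G`. The
chain estimate then applies with `a² = α` of order `√n` and `d² = β` of order `δ`. -/
theorem sum_lintegral_chain_truncGaussian_le {c R δ : ℝ} (hc : 0 < c) (hR : 0 ≤ R) (hδ : 0 < δ)
    {n : ℕ} (hn : 1 ≤ n) :
    ∑ l ∈ Fintype.piFinset (fun _ : Fin 4 => Finset.range (n + 1)),
      ∫⁻ t₄, ∫⁻ t₃, ∫⁻ t₂, ∫⁻ t₁,
        cutoffDist δ t₄ * truncGaussian c R (l 3) t₄ *
        (cutoffDist δ t₃ * truncGaussian c R (l 2) (t₃ + t₄)) *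
        (cutoffDist δ t₂ * truncGaussian c R (l 1) (t₂ + (t₃ + t₄))) *
        (cutoffDist δ t₁ * truncGaussian c R (l 0) (t₁ + (t₂ + (t₃ + t₄))))
      ≤ ENNReal.ofReal (8 * (2 * R + 2 * √(Real.pi / c)) ^ 2 *
          (2 * (R ^ 2 + c⁻¹) * Real.pi) ^ 2 * (n * δ ^ 2)) := by
  set G : ℝ → ℝ≥0∞ := fun u => ∑ l ∈ Finset.range (n + 1), truncGaussian c R l u with hG
  have hGm : Measurable G := Finset.measurable_sum _ fun l _ => measurable_truncGaussian c R l
  set α := (2 * R + 2 * √(Real.pi / c)) * √n with hα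
  set β := 2 * (R ^ 2 + c⁻¹) * Real.pi * δ with hβ
  have hα0 : 0 ≤ α := by positivity
  have hβ0 : 0 ≤ β := by positivity
  have hsq : ∀ {z : ℝ}, 0 ≤ z → ENNReal.ofReal z = ENNReal.ofReal √z * ENNReal.ofReal √z :=
    fun hz => by rw [← ENNReal.ofReal_mul (Real.sqrt_nonneg _), Real.mul_self_sqrt hz]
  have h0 : ∫⁻ u, G u ≤ ENNReal.ofReal √α * ENNReal.ofReal √α := by
    rw [← hsq hα0]; exact lintegral_sum_truncGaussian_le hc hR hn
  have h2 : ∫⁻ u, cutoffDist δ u ^ 2 * G u ≤ ENNReal.ofReal √β * ENNReal.ofReal √β := by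
    rw [← hsq hβ0]; exact lintegral_cutoffDist_sq_mul_le hc hδ (n + 1)
  have h1 := lintegral_mul_le_of_sq hGm (measurable_cutoffDist δ) h0 h2
  have hchain := lintegral_chain_four_le hGm (measurable_cutoffDist δ) h0 h1 h2
    (cutoffDist_sub_le hδ.le) (by simp [cutoffDist])
  refine (finset_sum_lintegral_le _ _ _).trans ((lintegral_mono fun t₄ => ?_).trans
    (hchain.trans (le_of_eq ?_)))
  · refine (finset_sum_lintegral_le _ _ _).trans (lintegral_mono fun t₃ => ?_)
    refine (finset_sum_lintegral_le _ _ _).trans (lintegral_mono fun t₂ => ?_)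
    refine (finset_sum_lintegral_le _ _ _).trans (lintegral_mono fun t₁ => le_of_eq ?_)
    have hprod := Finset.prod_univ_sum (fun _ : Fin 4 => Finset.range (n + 1))
      (fun (i : Fin 4) (j : ℕ) => truncGaussian c R j
        ((![t₁ + (t₂ + (t₃ + t₄)), t₂ + (t₃ + t₄), t₃ + t₄, t₄] : Fin 4 → ℝ) i))
    simp only [Fin.prod_univ_four, Matrix.cons_val] at hprod
    calc _ = cutoffDist δ t₄ * cutoffDist δ t₃ * cutoffDist δ t₂ * cutoffDist δ t₁ *
          (G (t₁ + (t₂ + (t₃ + t₄))) * G (t₂ + (t₃ + t₄)) * G (t₃ + t₄) * G t₄) := by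
          rw [hprod, Finset.mul_sum]
          refine Finset.sum_congr rfl fun l _ => ?_
          ring
      _ = _ := by ring
  · rw [← hsq hα0, ← hsq hβ0, ← ENNReal.ofReal_pow hα0, ← ENNReal.ofReal_pow hβ0,
      show (8 : ℝ≥0∞) = ENNReal.ofReal 8 by simp, ← ENNReal.ofReal_mul (by norm_num),
      ← ENNReal.ofReal_mul (by positivity)]
    congr 1
    rw [hα, hβ, mul_pow, Real.sq_sqrt (by positivity)]
    ring

end FourthMoment

/-! ### Additive functionals of the ergodic sums and the increments of local time -/

section Main

variable {X : Type*} [MeasurableSpace X] {m : Measure X} [IsProbabilityMeasure m]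
  {T : X → X} {φ : X → ℝ} {B : Type*} [NormedAddCommGroup B] [NormedSpace ℂ B]

/-- The fourth moment of additive functionals `∑_{k ≤ n} a(S_k)`, when the Fourier transform `g` of
`a` has bounded support and is dominated by `min(1, δ|t|)`. -/
theorem exists_integral_sum_pow_four_le (hT : MeasurePreserving T m m) (hφ : Measurable φ)
    {ι : B →L[ℂ] Lp ℂ ∞ m} {P : ℝ → B →L[ℂ] B} (hP : RestrictsTo T φ ι P) {e : B}
    (he : ι e =ᵐ[m] fun _ => 1) {K c r : ℝ} (hK : 0 ≤ K) (hc : 0 < c) (hr : 0 ≤ r)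
    (hop : ∀ u ∈ Set.Icc (-(4 * r)) (4 * r), ∀ k : ℕ,
      ‖P (2 * Real.pi * u) ^ k‖ ≤ K * Real.exp (-c * u ^ 2 * k)) {A : ℝ} (hA : 0 ≤ A) :
    ∃ C : ℝ, 0 ≤ C ∧ ∀ (g : ℝ → ℂ) (a : ℝ → ℝ) (δ K' : ℝ), Integrable g → Measurable a →
      (∀ s, |a s| ≤ K') → 0 < δ → (∀ t, ‖g t‖ ≤ A * min 1 (|t| * δ)) → (∀ t, r < |t| → g t = 0) →
      (∀ s, (a s : ℂ) = ∫ t, g t * phase t s) → ∀ n : ℕ, 1 ≤ n →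
      ∫ x, (∑ k ∈ Finset.Icc 1 n, a (ergodicSum T φ k x)) ^ 4 ∂m ≤ C * (n * δ ^ 2) := by
  -- Partial sums of at most four frequencies in `[-r, r]` stay in `[-R, R]`.
  set R := 4 * r with hR
  have hR0 : 0 ≤ R := by positivity
  set C₀ := ‖ι‖ * K ^ 4 * ‖e‖ with hC₀
  set C₁ := 8 * (2 * R + 2 * √(Real.pi / c)) ^ 2 * (2 * (R ^ 2 + c⁻¹) * Real.pi) ^ 2 with hC₁
  -- `24` counts the orderings, `A ^ 4` comes from the four factors `g`, `C₀` from the operators and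
  -- `C₁` from the chain of integrals. None depends on `g`, `a`, `δ` or `n`.
  refine ⟨24 * (A ^ 4 * C₀) * C₁, by positivity, ?_⟩
  intro g a δ K' hg ha hK' hδ hgA hgr hga n hn
  set S := ergodicSum T φ with hS
  have hSm : ∀ k, Measurable (S k) := measurable_ergodicSum hT.measurable hφ
  have hac : Measurable fun s => (a s : ℂ) := Complex.measurable_ofReal.comp ha
  have haK : ∀ s, ‖(a s : ℂ)‖ ≤ K' := fun s => by
    rw [Complex.norm_real]; exact hK' s
  set F : (Fin 4 → ℕ) → ℝ≥0∞ := fun k => ‖∫ x, ∏ i, (a (S (k i) x) : ℂ) ∂m‖ₑ with hF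
  have hterm : ∀ l : Fin 4 → ℕ, F (gapSum l) ≤ ENNReal.ofReal (A ^ 4 * C₀) *
      ∫⁻ t₄, ∫⁻ t₃, ∫⁻ t₂, ∫⁻ t₁,
        cutoffDist δ t₄ * truncGaussian c R (l 3) t₄ *
        (cutoffDist δ t₃ * truncGaussian c R (l 2) (t₃ + t₄)) *
        (cutoffDist δ t₂ * truncGaussian c R (l 1) (t₂ + (t₃ + t₄))) *
        (cutoffDist δ t₁ * truncGaussian c R (l 0) (t₁ + (t₂ + (t₃ + t₄)))) := by
    intro l
    refine (enorm_integral_prod_four_fourier_le hg (S := fun i => S (gapSum l i))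
      (fun i => hSm _) hac haK hga).trans ?_
    rw [← lintegral_const_mul' _ _ ENNReal.ofReal_ne_top]
    refine lintegral_mono fun t₄ => ?_
    rw [← lintegral_const_mul' _ _ ENNReal.ofReal_ne_top]
    refine lintegral_mono fun t₃ => ?_
    rw [← lintegral_const_mul' _ _ ENNReal.ofReal_ne_top]
    refine lintegral_mono fun t₂ => ?_
    rw [← lintegral_const_mul' _ _ ENNReal.ofReal_ne_top]
    refine lintegral_mono fun t₁ => ?_
    have hsplit : ∫ x, g t₄ * phase t₄ (S (gapSum l 3) x) * (g t₃ * phase t₃ (S (gapSum l 2) x)) *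
          (g t₂ * phase t₂ (S (gapSum l 1) x)) * (g t₁ * phase t₁ (S (gapSum l 0) x)) ∂m
        = g t₄ * g t₃ * g t₂ * g t₁ * ∫ x, phase t₄ (S (gapSum l 3) x) *
          phase t₃ (S (gapSum l 2) x) * phase t₂ (S (gapSum l 1) x) *
          phase t₁ (S (gapSum l 0) x) ∂m := by
      rw [← integral_const_mul]
      refine integral_congr_ae (ae_of_all _ fun x => ?_)
      ring
    rw [hsplit]
    by_cases hall : |t₄| ≤ r ∧ |t₃| ≤ r ∧ |t₂| ≤ r ∧ |t₁| ≤ r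
    swap
    · have hz : g t₄ * g t₃ * g t₂ * g t₁ = 0 := by
        by_contra h
        simp only [mul_eq_zero, not_or] at h
        exact hall ⟨not_lt.1 fun h' => h.1.1.1 (hgr _ h'), not_lt.1 fun h' => h.1.1.2 (hgr _ h'),
          not_lt.1 fun h' => h.1.2 (hgr _ h'), not_lt.1 fun h' => h.2 (hgr _ h')⟩
      rw [hz, zero_mul, enorm_zero]
      exact zero_le
    obtain ⟨b4, b3, b2, b1⟩ := hall
    rw [abs_le] at b4 b3 b2 b1
    have hph := enorm_integral_phase_four_le hT hφ hP he hK hop (t₁ := t₁) (t₂ := t₂) (t₃ := t₃)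
      (t₄ := t₄) ⟨by linarith, by linarith⟩ ⟨by linarith, by linarith⟩ ⟨by linarith, by linarith⟩
      ⟨by linarith, by linarith⟩ l
    have hge : ∀ t, ‖g t‖ₑ ≤ ENNReal.ofReal A * cutoffDist δ t := fun t => by
      rw [← ofReal_norm, cutoffDist, ← ENNReal.ofReal_mul hA]
      exact ENNReal.ofReal_le_ofReal (hgA t)
    rw [enorm_mul, enorm_mul, enorm_mul, enorm_mul]
    refine (mul_le_mul' (mul_le_mul' (mul_le_mul' (mul_le_mul' (hge t₄) (hge t₃)) (hge t₂))
      (hge t₁)) hph).trans (le_of_eq ?_)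
    have hAC : ENNReal.ofReal (A ^ 4 * C₀) = ENNReal.ofReal A ^ 4 * ENNReal.ofReal C₀ := by
      rw [ENNReal.ofReal_mul (by positivity), ENNReal.ofReal_pow hA]
    rw [hAC, hC₀]
    ring
  have hsum : ∑ k ∈ Fintype.piFinset (fun _ : Fin 4 => Finset.Icc 1 n), F k
      ≤ ENNReal.ofReal (24 * (A ^ 4 * C₀) * C₁ * (n * δ ^ 2)) := by
    have hsymm : ∀ k (τ : Equiv.Perm (Fin 4)), F (k ∘ τ) = F k := fun k τ => by
      simp only [hF, Function.comp_apply]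
      congr 1
      refine integral_congr_ae (ae_of_all _ fun x => ?_)
      exact Equiv.prod_comp τ fun i => (a (S (k i) x) : ℂ)
    refine (sum_quadruples_le F hsymm n).trans ?_
    calc _ ≤ 24 * (ENNReal.ofReal (A ^ 4 * C₀) * ENNReal.ofReal (C₁ * (n * δ ^ 2))) := by
          gcongr
          refine (Finset.sum_le_sum fun l _ => hterm l).trans ?_
          rw [← Finset.mul_sum]
          gcongr
          exact sum_lintegral_chain_truncGaussian_le hc hR0 hδ hn
      _ = _ := by
          rw [show (24 : ℝ≥0∞) = ENNReal.ofReal 24 by simp, ← ENNReal.ofReal_mul (by positivity),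
            ← ENNReal.ofReal_mul (by norm_num)]
          congr 1
          ring
  have hexpand : ((∫ x, (∑ k ∈ Finset.Icc 1 n, a (S k x)) ^ 4 ∂m : ℝ) : ℂ)
      = ∑ k ∈ Fintype.piFinset (fun _ : Fin 4 => Finset.Icc 1 n),
        ∫ x, ∏ i, (a (S (k i) x) : ℂ) ∂m := by
    rw [← integral_finsetSum]
    · rw [← integral_complex_ofReal]
      refine integral_congr_ae (ae_of_all _ fun x => ?_)
      push_cast
      exact Finset.sum_pow' _ _ 4
    · intro k _
      refine Integrable.of_bound (C := K' ^ 4) ?_ (ae_of_all _ fun x => ?_)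
      · exact (Finset.measurable_prod _ fun i _ => hac.comp (hSm (k i))).aestronglyMeasurable
      · rw [norm_prod]
        refine (Finset.prod_le_prod (fun i _ => norm_nonneg _) fun i _ => haK _).trans ?_
        simp
  set J := ∫ x, (∑ k ∈ Finset.Icc 1 n, a (S k x)) ^ 4 ∂m with hJ
  have hJe : ENNReal.ofReal ‖(J : ℂ)‖ ≤ ENNReal.ofReal (24 * (A ^ 4 * C₀) * C₁ * (n * δ ^ 2)) := by
    rw [ofReal_norm, hexpand]
    exact (enorm_sum_le _ _).trans hsum
  rw [ENNReal.ofReal_le_ofReal_iff (by positivity), Complex.norm_real] at hJe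
  exact (le_abs_self J).trans hJe

end Main

theorem mainTheorem3 {X : Type*} [MeasurableSpace X] (m : Measure X) [IsProbabilityMeasure m]
    (T : X → X) (hT : MeasurePreserving T m m)
    (φ : X → ℝ) (hφ : Measurable φ) (hφ2 : MemLp φ 2 m) (hφ0 : ∫ x, φ x ∂m = 0)
    {B : Type*} [NormedAddCommGroup B] [NormedSpace ℂ B] [CompleteSpace B]
    (ι : B →L[ℂ] Lp ℂ ∞ m)
    (hι : IsBanachFunctionSpace ι)
    (P : ℝ → B →L[ℂ] B) (hP : RestrictsTo T φ ι P)
    (hquasi : IsQuasiCompactTransfer ι P)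
    (hcont : Continuous P)
    (hdiff : IsDifferentiableNearZero T φ ι P)
    (haper : IsAperiodicFamily P)
    {Ω : Type*} [MeasurableSpace Ω] (Q : Measure Ω) [IsProbabilityMeasure Q]
    (hFIP : FunctionalInvariancePrinciple m T φ Q)
    (f : ℝ → ℝ) (hf : ContDiff ℝ ∞ f) (hfint : Integrable f) (hfsymm : ∀ s, f (-s) = f s)
    (hfhat : HasCompactSupport (𝓕 fun s : ℝ => (f s : ℂ))) :
    (∃ C : ℝ, 0 < C ∧ ∀ (n : ℕ) (x y : ℝ),
      Integrable (fun ξ => (∑ k ∈ Finset.Icc 1 n,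
        (f (ergodicSum T φ k ξ - x) - f (ergodicSum T φ k ξ - y))) ^ 4) m ∧
      ∫ ξ, (∑ k ∈ Finset.Icc 1 n,
        (f (ergodicSum T φ k ξ - x) - f (ergodicSum T φ k ξ - y))) ^ 4 ∂m
        ≤ C * (n * |x - y| ^ 2)) ∧
    (∃ C : ℝ, 0 < C ∧ ∀ (n : ℕ) (x y : ℝ),
      Integrable (fun ξ => (localTime T φ f n x ξ - localTime T φ f n y ξ) ^ 4) m ∧
      ∫ ξ, (localTime T φ f n x ξ - localTime T φ f n y ξ) ^ 4 ∂m ≤ C * |x - y| ^ 2) := by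
  obtain ⟨F, A, r, hFi, hA, hr, hFA, hFr, hFf⟩ :=
    exists_fourier_representation hf.continuous hfint hfhat
  obtain ⟨e, he⟩ := hι.one_mem
  obtain ⟨K, c, hK, hc, hPK⟩ := exists_norm_pow_le_gaussian hT hφ hι hP hquasi hcont haper hFIP
    (isCompact_Icc (a := -(2 * Real.pi * (4 * r))) (b := 2 * Real.pi * (4 * r)))
  have hπ := Real.two_pi_pos
  have hop : ∀ u ∈ Set.Icc (-(4 * r)) (4 * r), ∀ k : ℕ,
      ‖P (2 * Real.pi * u) ^ k‖ ≤ K * Real.exp (-(c * (2 * Real.pi) ^ 2) * u ^ 2 * k) := by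
    intro u hu k
    refine (hPK (2 * Real.pi * u) ⟨?_, ?_⟩ k).trans (le_of_eq ?_)
    · rw [← mul_neg]; exact mul_le_mul_of_nonneg_left hu.1 hπ.le
    · exact mul_le_mul_of_nonneg_left hu.2 hπ.le
    · congr 2; ring
  -- The factor `2π` in the amplitude is the constant of `norm_phase_sub_le`; the `(2π)²` in the
  -- rate comes from the normalization of `phase`.
  obtain ⟨C, hC, hmain⟩ := exists_integral_sum_pow_four_le hT hφ hP he hK.le
    (by positivity : 0 < c * (2 * Real.pi) ^ 2) hr hop (A := A * (2 * Real.pi)) (by positivity)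
  have hFint : ∀ s, Integrable fun t => F t * phase t s := fun s =>
    hFi.mul_bdd (c := 1)
      (measurable_phase.comp (measurable_id.prodMk measurable_const)).aestronglyMeasurable
      (ae_of_all _ fun t => (norm_phase t s).le)
  have hfb : ∀ s, |f s| ≤ ∫ t, ‖F t‖ := fun s => by
    rw [← Real.norm_eq_abs, ← Complex.norm_real, hFf]
    refine (norm_integral_le_integral_norm _).trans (le_of_eq ?_)
    refine integral_congr_ae (ae_of_all _ fun t => ?_)
    simp only [norm_mul, norm_phase, mul_one]
  have hfm : Measurable f := hf.continuous.measurable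
  have hSm : ∀ k, Measurable (ergodicSum T φ k) := measurable_ergodicSum hT.measurable hφ
  have hint : ∀ (n : ℕ) (x y : ℝ), Integrable (fun ξ => (∑ k ∈ Finset.Icc 1 n,
      (f (ergodicSum T φ k ξ - x) - f (ergodicSum T φ k ξ - y))) ^ 4) m := by
    intro n x y
    refine Integrable.of_bound (C := (∑ _k ∈ Finset.Icc 1 n, 2 * ∫ t, ‖F t‖) ^ 4) ?_
      (ae_of_all _ fun ξ => ?_)
    · refine Measurable.aestronglyMeasurable (Measurable.pow_const
        (Finset.measurable_sum _ fun k _ => ?_) 4)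
      exact (hfm.comp ((hSm k).sub_const x)).sub (hfm.comp ((hSm k).sub_const y))
    · rw [norm_pow]
      gcongr
      refine norm_sum_le_of_le _ fun k _ => (norm_sub_le _ _).trans ?_
      rw [Real.norm_eq_abs, Real.norm_eq_abs, two_mul]
      exact add_le_add (hfb _) (hfb _)
  have hbound : ∀ (n : ℕ) (x y : ℝ), ∫ ξ, (∑ k ∈ Finset.Icc 1 n,
      (f (ergodicSum T φ k ξ - x) - f (ergodicSum T φ k ξ - y))) ^ 4 ∂m
        ≤ C * (n * |x - y| ^ 2) := by
    intro n x y
    rcases Nat.eq_zero_or_pos n with rfl | hn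
    · simp
    rcases eq_or_ne x y with rfl | hxy
    · simp
    -- Translating `f` multiplies its transform by a phase, so the difference of two translates
    -- gains the cut-off with `δ = |x - y|`.
    refine hmain (fun t => F t * (phase t (-x) - phase t (-y))) (fun s => f (s - x) - f (s - y))
      |x - y| (2 * ∫ t, ‖F t‖) ?_ ?_ ?_ (abs_pos.2 (sub_ne_zero.2 hxy)) ?_ ?_ ?_ n hn
    · exact ((hFint (-x)).sub (hFint (-y))).congr (ae_of_all _ fun t => (mul_sub _ _ _).symm)
    · exact (hfm.comp (measurable_id.sub_const x)).sub (hfm.comp (measurable_id.sub_const y))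
    · intro s
      refine (abs_sub _ _).trans ?_
      rw [two_mul]
      exact add_le_add (hfb _) (hfb _)
    · intro t
      rw [norm_mul, mul_assoc]
      have h1 := norm_phase_sub_le t (-x) (-y)
      rw [show -x - -y = -(x - y) by ring, abs_neg] at h1
      exact mul_le_mul (hFA t) h1 (norm_nonneg _) hA
    · intro t ht
      simp only [hFr t ht, zero_mul]
    · intro s
      push_cast
      rw [hFf, hFf, ← integral_sub (hFint _) (hFint _)]
      refine integral_congr_ae (ae_of_all _ fun t => ?_)
      simp only [sub_eq_add_neg s, phase_add_right]
      ring
  -- `C` is only known to be nonnegative; adding `1` makes the constant positive.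
  refine ⟨⟨C + 1, by linarith, fun n x y => ⟨hint n x y, (hbound n x y).trans ?_⟩⟩,
    C + 1, by linarith, fun n x y => ?_⟩
  · gcongr; linarith
  · have hlt : ∀ ξ, (localTime T φ f n x ξ - localTime T φ f n y ξ) ^ 4
        = (√n)⁻¹ ^ 4 * (∑ k ∈ Finset.Icc 1 n, (f (ergodicSum T φ k ξ - √n * x)
          - f (ergodicSum T φ k ξ - √n * y))) ^ 4 := by
      intro ξ
      rw [localTime, localTime, ← mul_sub, ← Finset.sum_sub_distrib, mul_pow]
    simp only [hlt]
    refine ⟨(hint n _ _).const_mul _, ?_⟩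
    rw [integral_const_mul]
    rcases Nat.eq_zero_or_pos n with rfl | hn
    · simp; positivity
    have hn' : (0 : ℝ) < n := by exact_mod_cast hn
    have hs : 0 < √(n : ℝ) := Real.sqrt_pos.2 hn'
    -- The prefactor is `n⁻²`, and spreading the points by `√n` turns `n |x - y|²` into `n² |x -
    -- y|²`, so the powers of `n` cancel.
    calc _ ≤ (√(n : ℝ))⁻¹ ^ 4 * (C * (n * |√n * x - √n * y| ^ 2)) := by
          gcongr
          exact hbound n _ _
      _ = C * |x - y| ^ 2 := by
          rw [← mul_sub, abs_mul, abs_of_pos hs, mul_pow, Real.sq_sqrt hn'.le, inv_pow,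
            show √(n : ℝ) ^ 4 = n ^ 2 by
              rw [show 4 = 2 * 2 by norm_num, pow_mul, Real.sq_sqrt hn'.le]]
          field_simp
      _ ≤ (C + 1) * |x - y| ^ 2 := by gcongr; linarith
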